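/- Fix a sorting of names (each sort has countably many names, and prescribes the sorts of the names carried). Let $[\![\cdot]\!]$ be a compositional and uniform encoding of the untyped $\lambda$-calculus into the (well-sorted) asynchronous polyadic $\pi$-calculus, mapping each term $M$ to a unary abstraction $[\![M]\!]$. Thus $\lambda$-variables are included in the names; $[\![\lambda x.M]\!]=C_\lambda^x[[\![M]\!]]$ and $[\![MN]\!]=C_{\mathrm{app}}[[\![M]\!],[\![N]\!]]$ for fixed contexts, where $x$ occurs in $C_\lambda^x$ only as a bound name whose scope embraces the hole; the encoding respects $\alpha$-conversion, commutes with variable renamings, and the free names of $[\![M]\!]$ are free variables of $M$. Let $\asymp$ be a congruence on $\pi$-agents (processes and abstractions), and suppose that there is a precongruence $\leq$ on $\pi$-agents, with converse $\geq$, such that: 1. ${\geq}\subseteq{\asymp}$; 2. $\leq$ is an expansion relation on processes: whenever $P\leq Q$, if $P\xrightarrow{\mu}P'$ then $Q\Rightarrow\xrightarrow{\mu}\Rightarrow Q'$ for some $Q'$ with $P'\leq Q'$; and if $Q\xrightarrow{\mu}Q'$ then, for some $P'$ with $P'\leq Q'$, either $P\xrightarrow{\mu}P'$, or $\mu=\tau$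 and $P'=P$; 3. $\asymp$ validates the up-to-$\leq$-and-contexts technique: a symmetric relation $\mathcal R$ on processes is included in $\asymp$ whenever for all $(P,Q)\in\mathcal R$, if $P\xrightarrow{\mu}P'$ then $Q\stackrel{\hat\mu}{\Rightarrow}Q'$ and $P'\geq C[\tilde P]$, $Q'\geq C[\tilde Q]$ for some $Q'$, some context $C$ and some tuples $\tilde P,\tilde Q$ of processes of the same length such that for each $i$ either $P_i\asymp Q_i$, or $P_i\mathrel{\mathcal R}Q_i$ and, if the hole $[\cdot]_i$ occurs under an input in $C$, also $P_i\sigma\mathrel{\mathcal R}Q_i\sigma$ for all name substitutions $\sigma$; 4. the variable contexts $[\![x[\cdot]_1\cdots[\cdot]_n]\!]$ are guarded, i.e. their holes occur only underneath prefixes; 5. $[\![(\lambda x.M)N]\!]\geq[\![M\{N/x\}]\!]$ for all $x,M,N$; 6. $[\![M]\!]\asymp[\![\Omega]\!]$ whenever $M$ is unsolvable of order $0$; 7. $[\![M]\!]\asymp[\![N]\!]$ whenever $M$ and $N$ are both unsolvable of order $\infty$. (In 2 and 3 the bound names of $\mu$ are, as usual, fresh for the process that has to match the action. The abstraction contexts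 $C_\lambda^x$ are not required to be guarded.) Then $[\![\cdot]\!]$ and $\asymp$ are complete for Lévy–Longo trees: if $M$ and $N$ have the same Lévy–Longo tree, then $[\![M]\!]\asymp[\![N]\!]$. Consequently, if in addition $[\![\cdot]\!]$ and $\asymp$ are sound for Lévy–Longo trees ($[\![M]\!]\asymp[\![N]\!]$ implies that $M$ and $N$ have the same tree), they are fully abstract for Lévy–Longo trees. -/

import Mathlib

namespace TreesPi

/-! # The `λ`-calculus

Terms modulo `α`-conversion, in de Bruijn notation.  The `λ`-variables are the natural numbers: an
index that points outside all enclosing binders is a free variable, so the free variable `x` of a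
term is written `var x` outside binders. -/

inductive Term : Type
  | var (x : ℕ) : Term
  | app (M N : Term) : Term
  | lam (M : Term) : Term

namespace Term

/-- Extension of a renaming under one binder. -/
def liftRen (f : ℕ → ℕ) : ℕ → ℕ
  | 0 => 0
  | x + 1 => f x + 1

/-- `M σ` for a variable renaming `σ`. -/
def rename : (ℕ → ℕ) → Term → Term
  | f, var x => var (f x)
  | f, app M N => app (M.rename f) (N.rename f)
  | f, lam M => lam (M.rename (liftRen f))

/-- Extension of a substitution under one binder. -/
def liftSubst (f : ℕ → Term) : ℕ → Term
  | 0 => var 0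
  | x + 1 => (f x).rename Nat.succ

/-- Simultaneous capture-avoiding substitution. -/
def subst : (ℕ → Term) → Term → Term
  | f, var x => f x
  | f, app M N => app (M.subst f) (N.subst f)
  | f, lam M => lam (M.subst (liftSubst f))

/-- Contraction of a `β`-redex: the body `M` of an abstraction, instantiated with `N`. -/
def inst (M N : Term) : Term :=
  M.subst (fun x => Nat.casesOn x N var)

/-- The term `λ x. M`, for a named variable `x`. -/
def abs (x : ℕ) (M : Term) : Term :=
  lam (M.rename (fun y => if y = x then 0 else y + 1))

/-- The term `M{N/x}`, for a named variable `x`. -/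
def substVar (M : Term) (x : ℕ) (N : Term) : Term :=
  M.subst (fun y => if y = x then N else var y)

/-- The free variables of a term. -/
def fv : Term → Set ℕ
  | var x => {x}
  | app M N => M.fv ∪ N.fv
  | lam M => {x | x + 1 ∈ M.fv}

/-- `λ x₁ … xₙ. M`. -/
def lams : ℕ → Term → Term
  | 0, M => M
  | n + 1, M => lam (lams n M)

/-- `M N₁ … Nₖ`. -/
def apps (M : Term) (Ns : List Term) : Term := Ns.foldl app M

/-- `Ω = (λ x. x x) (λ x. x x)`. -/
def Omega : Term :=
  app (lam (app (var 0) (var 0))) (lam (app (var 0) (var 0)))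

/-- One step of head reduction: contraction of the redex `(λ x. M₀) M₁` of a term
`λ x₁ … xₘ. (λ x. M₀) M₁ … Mₙ`, `n ≥ 1`. -/
inductive HeadStep : Term → Term → Prop
  | beta (M N : Term) : HeadStep (app (lam M) N) (M.inst N)
  | appL {M M' : Term} (N : Term) : (∀ K, M ≠ lam K) → HeadStep M M' →
      HeadStep (app M N) (app M' N)
  | lam {M M' : Term} : HeadStep M M' → HeadStep (lam M) (lam M')

/-- Head reduction. -/
def HeadRed : Term → Term → Prop := Relation.ReflTransGen HeadStep

/-- `M` has the head normal form `λ x₁ … xₙ. y M₁ … Mₖ`. -/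
def HasHnf (M : Term) (n y : ℕ) (Ms : List Term) : Prop :=
  HeadRed M (lams n (apps (var y) Ms))

def Solvable (M : Term) : Prop := ∃ n y Ms, HasHnf M n y Ms

/-- `M` head-reduces to a term that starts with (at least) `n` abstractions. -/
def Uncovers (M : Term) (n : ℕ) : Prop := ∃ M', HeadRed M (lams n M')

/-- `M` is unsolvable of finite order `n`. -/
def UnsolvableOfOrder (M : Term) (n : ℕ) : Prop :=
  ¬ M.Solvable ∧ IsGreatest {m | M.Uncovers m} n

/-- `M` is unsolvable of order `∞`. -/
def UnsolvableOfOrderInf (M : Term) : Prop :=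
  ¬ M.Solvable ∧ ∀ n, M.Uncovers n

end Term

/-! ## Lévy–Longo trees -/

/-- The labels of the nodes: `⊤`, `λ x₁ … xₙ. ⊥`, and `λ x₁ … xₙ. y` with `k` children.  In de Bruijn
notation the names of the bound variables do not matter; the label of the head variable `y` is its
index, below all the abstractions on the path from the root. -/
inductive LTLabel : Type
  | top : LTLabel
  | bot (n : ℕ) : LTLabel
  | node (n y k : ℕ) : LTLabel

/-- The positions of the children of a node. -/
def LTLabel.Child : LTLabel → Type
  | top => Empty
  | bot _ => Empty
  | node _ _ k => Fin k

/-- The functor whose final coalgebra consists of the finite and infinite labelled trees. -/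
def LTFunctor : PFunctor.{0, 0} := ⟨LTLabel, LTLabel.Child⟩

/-- Finite and infinite labelled trees. -/
abbrev LTree : Type := PFunctor.M LTFunctor

open Classical in
/-- The root of the Lévy–Longo tree of `M`, together with the terms whose trees are the children.
A term that is neither solvable nor unsolvable of a finite order is unsolvable of order `∞`. -/
noncomputable def ltStep (M : Term) : LTFunctor.Obj Term :=
  if h : ∃ r : ℕ × ℕ × List Term, M.HasHnf r.1 r.2.1 r.2.2 then
    ⟨LTLabel.node h.choose.1 h.choose.2.1 h.choose.2.2.length,
      fun i : Fin h.choose.2.2.length => h.choose.2.2.get i⟩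
  else if h : ∃ n, M.UnsolvableOfOrder n then ⟨LTLabel.bot h.choose, Empty.elim⟩
  else ⟨LTLabel.top, Empty.elim⟩

/-- The Lévy–Longo tree of a term, by corecursion. -/
noncomputable def LT : Term → LTree := PFunctor.M.corec ltStep

/-! # The asynchronous polyadic `π`-calculus -/

/-- A sorting: names of sort `s` carry tuples of `ar s` names, of the sorts `ob s 0, ob s 1, …`. -/
structure Sorting where
  S : Type
  ar : S → ℕ
  ob : (s : S) → Fin (ar s) → S

variable {G : Sorting}

/-- The names available in scope `X`, extended with bound names `B`. -/
abbrev Ext (X B : G.S → Type) : G.S → Type := fun u => X u ⊕ B u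

/-- The single name, of sort `s`, bound by a restriction or an abstraction. -/
abbrev One (s : G.S) : G.S → Type := fun u => PLift (s = u)

/-- The parameters bound by an input on a name of sort `s`. -/
abbrev Par (s : G.S) : G.S → Type := fun u => {i : Fin (G.ar s) // G.ob s i = u}

/-- Well-sorted processes, modulo `α`-conversion, whose free names of sort `u` belong to `X u`.
A binder extends the scope. Since an abstraction `(b)P` is given by its body, the application
`F⟨a⟩` of `F = (b)P` is `app P a`. -/
inductive Proc : (G.S → Type) → Type 1
  | nil {X : G.S → Type} : Proc X
  | inp {X : G.S → Type} {s : G.S} (a : X s) (P : Proc (Ext X (Par s))) : Proc X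
  | out {X : G.S → Type} {s : G.S} (a : X s) (b : ∀ i, X (G.ob s i)) : Proc X
  | par {X : G.S → Type} (P Q : Proc X) : Proc X
  | res {X : G.S → Type} {s : G.S} (P : Proc (Ext X (One s))) : Proc X
  | rep {X : G.S → Type} {s : G.S} (a : X s) (P : Proc (Ext X (Par s))) : Proc X
  | app {X : G.S → Type} {s : G.S} (P : Proc (Ext X (One s))) (a : X s) : Proc X

/-- Extension of a (sort-respecting) name substitution under a binder. -/
def liftMap {X Y B : G.S → Type} (f : ∀ u, X u → Y u) : ∀ u, Ext X B u → Ext Y B u :=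
  fun u => Sum.map (f u) id

/-- Simultaneous capture-avoiding substitution of names for names. -/
def Proc.map : {X Y : G.S → Type} → (∀ u, X u → Y u) → Proc X → Proc Y
  | _, _, _, nil => nil
  | _, _, f, inp a P => inp (f _ a) (P.map (liftMap f))
  | _, _, f, out a b => out (f _ a) (fun i => f _ (b i))
  | _, _, f, par P Q => par (P.map f) (Q.map f)
  | _, _, f, res P => res (P.map (liftMap f))
  | _, _, f, rep a P => rep (f _ a) (P.map (liftMap f))
  | _, _, f, app P a => app (P.map (liftMap f)) (f _ a)

/-- The free names of a process. -/
def Proc.fn : {X : G.S → Type} → Proc X → Set (Σ u, X u)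
  | _, nil => ∅
  | _, inp a P => {⟨_, a⟩} ∪ {x | ⟨x.1, Sum.inl x.2⟩ ∈ P.fn}
  | _, out a b => {⟨_, a⟩} ∪ Set.range (fun i => ⟨_, b i⟩)
  | _, par P Q => P.fn ∪ Q.fn
  | _, res P => {x | ⟨x.1, Sum.inl x.2⟩ ∈ P.fn}
  | _, rep a P => {⟨_, a⟩} ∪ {x | ⟨x.1, Sum.inl x.2⟩ ∈ P.fn}
  | _, app P a => {⟨_, a⟩} ∪ {x | ⟨x.1, Sum.inl x.2⟩ ∈ P.fn}

/-- A choice of the name `c` for the name bound by a restriction or an abstraction. -/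
def single {X : G.S → Type} {s : G.S} (c : X s) : ∀ u, One s u → X u :=
  fun _ h => h.down ▸ c

/-- A choice of the names `b` for the parameters bound by an input. -/
def tuple {X : G.S → Type} {s : G.S} (b : ∀ i, X (G.ob s i)) : ∀ u, Par s u → X u :=
  fun _ i => i.2 ▸ b i.1

/-- Instantiation of the bound names `B` of a body with the names `β`. -/
def Proc.inst {X B : G.S → Type} (P : Proc (Ext X B)) (β : ∀ u, B u → X u) : Proc X :=
  P.map (fun u => Sum.elim id (β u))

open Classical in
/-- Binding of the free names `β` of a process. -/
noncomputable def Proc.bind {X B : G.S → Type} (P : Proc X) (β : ∀ u, B u → X u) :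
    Proc (Ext X B) :=
  P.map (fun u x => if h : ∃ i : B u, β u i = x then Sum.inr h.choose else Sum.inl x)

/-- The names: countably many of each sort. -/
abbrev Name (G : Sorting) : G.S → Type := fun _ => ℕ

/-- A name together with its sort. -/
abbrev SName (G : Sorting) : Type := Σ u, Name G u

/-- The processes of the calculus. -/
abbrev PiProc (G : Sorting) : Type 1 := Proc (Name G)

/-- The names of a tuple are pairwise different. -/
def Distinct {s : G.S} (b : ∀ i, Name G (G.ob s i)) : Prop :=
  Function.Injective (fun i => (⟨G.ob s i, b i⟩ : SName G))

/-- The substitution `P{b/c}`, for tuples of names. -/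
noncomputable def Proc.substTuple {s : G.S} (P : PiProc G) (b c : ∀ i, Name G (G.ob s i)) :
    PiProc G :=
  (P.bind (tuple c)).inst (tuple b)

/-- The process `(ν c) P`, for a named `c`. -/
noncomputable def Proc.nu {s : G.S} (c : Name G s) (P : PiProc G) : PiProc G :=
  Proc.res (P.bind (single c))

/-- The process `(ν c₁) … (ν cₙ) P`. -/
noncomputable def Proc.nus : List (SName G) → PiProc G → PiProc G
  | [], P => P
  | c :: cs, P => Proc.nu c.2 (Proc.nus cs P)

/-! ## Transitions -/

/-- The actions: `τ`, input `a(b)`, and output `(ν D) a⟨b⟩` where `D` is the set of extruded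
names. -/
inductive Act (G : Sorting) : Type
  | tau : Act G
  | inp {s : G.S} (a : Name G s) (b : ∀ i, Name G (G.ob s i)) : Act G
  | out (D : Set (SName G)) {s : G.S} (a : Name G s) (b : ∀ i, Name G (G.ob s i)) : Act G

/-- The bound names of an action. -/
def Act.bn : Act G → Set (SName G)
  | tau => ∅
  | inp _ b => Set.range (fun i => ⟨_, b i⟩)
  | out D _ _ => D

/-- The names of an action. -/
def Act.names : Act G → Set (SName G)
  | tau => ∅
  | inp a b => {⟨_, a⟩} ∪ Set.range (fun i => ⟨_, b i⟩)
  | out D a b => {⟨_, a⟩} ∪ Set.range (fun i => ⟨_, b i⟩) ∪ D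

/-- The transition relation. Processes are taken modulo `α`-conversion: a binder may be opened with
any names that are fresh for the process. -/
inductive Step : PiProc G → Act G → PiProc G → Prop
  | inp {s : G.S} (a : Name G s) (P : Proc (Ext (Name G) (Par s))) (b : ∀ i, Name G (G.ob s i)) :
      Distinct b → Disjoint (Act.inp a b).bn (Proc.inp a P).fn →
      Step (Proc.inp a P) (Act.inp a b) (P.inst (tuple b))
  | rep {s : G.S} (a : Name G s) (P : Proc (Ext (Name G) (Par s))) (b : ∀ i, Name G (G.ob s i)) :
      Distinct b → Disjoint (Act.inp a b).bn (Proc.rep a P).fn →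
      Step (Proc.rep a P) (Act.inp a b) (Proc.par (P.inst (tuple b)) (Proc.rep a P))
  | out {s : G.S} (a : Name G s) (b : ∀ i, Name G (G.ob s i)) :
      Step (Proc.out a b) (Act.out ∅ a b) Proc.nil
  | parL {P P' : PiProc G} {μ : Act G} (Q : PiProc G) :
      Step P μ P' → Disjoint μ.bn Q.fn → Step (Proc.par P Q) μ (Proc.par P' Q)
  | parR {Q Q' : PiProc G} {μ : Act G} (P : PiProc G) :
      Step Q μ Q' → Disjoint μ.bn P.fn → Step (Proc.par P Q) μ (Proc.par P Q')
  | comL {P P' Q Q' : PiProc G} {s : G.S} {a : Name G s} {b c : ∀ i, Name G (G.ob s i)}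
      {D : Set (SName G)} (d : List (SName G)) :
      Step P (Act.inp a c) P' → Step Q (Act.out D a b) Q' → Disjoint D P.fn →
      d.Nodup → {x | x ∈ d} = D →
      Step (Proc.par P Q) Act.tau (Proc.nus d (Proc.par (P'.substTuple b c) Q'))
  | comR {P P' Q Q' : PiProc G} {s : G.S} {a : Name G s} {b c : ∀ i, Name G (G.ob s i)}
      {D : Set (SName G)} (d : List (SName G)) :
      Step P (Act.out D a b) P' → Step Q (Act.inp a c) Q' → Disjoint D Q.fn →
      d.Nodup → {x | x ∈ d} = D →
      Step (Proc.par P Q) Act.tau (Proc.nus d (Proc.par P' (Q'.substTuple b c)))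
  | res {s : G.S} {P : Proc (Ext (Name G) (One s))} {P' : PiProc G} {μ : Act G} (c : Name G s) :
      (⟨s, c⟩ : SName G) ∉ (Proc.res P).fn → Step (P.inst (single c)) μ P' →
      (⟨s, c⟩ : SName G) ∉ μ.names →
      Step (Proc.res P) μ (Proc.nu c P')
  | opn {s t : G.S} {P : Proc (Ext (Name G) (One s))} {P' : PiProc G} {D : Set (SName G)}
      {a : Name G t} {b : ∀ i, Name G (G.ob t i)} (c : Name G s) :
      (⟨s, c⟩ : SName G) ∉ (Proc.res P).fn → Step (P.inst (single c)) (Act.out D a b) P' →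
      (⟨s, c⟩ : SName G) ∈ Set.range (fun i => (⟨G.ob t i, b i⟩ : SName G)) →
      (⟨s, c⟩ : SName G) ∉ D → (⟨t, a⟩ : SName G) ≠ ⟨s, c⟩ →
      Step (Proc.res P) (Act.out (insert ⟨s, c⟩ D) a b) P'
  | app {s : G.S} {P : Proc (Ext (Name G) (One s))} {P' : PiProc G} {μ : Act G} (b : Name G s) :
      Step (P.inst (single b)) μ P' → Step (Proc.app P b) μ P'

/-- The reflexive and transitive closure of `τ` transitions. -/
def WeakTau : PiProc G → PiProc G → Prop :=
  Relation.ReflTransGen (fun P Q => Step P Act.tau Q)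

/-- Weak transitions. -/
def Weak (P : PiProc G) (μ : Act G) (P' : PiProc G) : Prop :=
  ∃ P₁ P₂, WeakTau P P₁ ∧ Step P₁ μ P₂ ∧ WeakTau P₂ P'

/-- Weak transitions, where a `τ` may be matched by no transition. -/
def WeakHat (P : PiProc G) (μ : Act G) (P' : PiProc G) : Prop :=
  Weak P μ P' ∨ (μ = Act.tau ∧ WeakTau P P')

/-- Strong transitions, where a `τ` may be matched by no transition. -/
def StepHat (P : PiProc G) (μ : Act G) (P' : PiProc G) : Prop :=
  Step P μ P' ∨ (μ = Act.tau ∧ P' = P)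

/-- Expansion relations. As usual, the bound names of the action of one process are fresh for the
other process. -/
def IsExpansion (R : PiProc G → PiProc G → Prop) : Prop :=
  ∀ P Q, R P Q →
    (∀ μ P', Step P μ P' → Disjoint μ.bn Q.fn → ∃ Q', Weak Q μ Q' ∧ R P' Q') ∧
    (∀ μ Q', Step Q μ Q' → Disjoint μ.bn P.fn → ∃ P', StepHat P μ P' ∧ R P' Q')

/-! ## Agents and contexts -/

/-- The kinds of agents: processes, and abstractions `(b)P` whose parameter `b` has sort `s`. -/
inductive Kind (G : Sorting) : Type
  | proc : Kind G
  | abs (s : G.S) : Kind G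

/-- The agents of each kind; an abstraction is given by its body. -/
def Agent : Kind G → Type 1
  | Kind.proc => PiProc G
  | Kind.abs s => Proc (Ext (Name G) (One s))

/-- The substitution of names in an agent. -/
def Agent.map (σ : ∀ u, Name G u → Name G u) : {k : Kind G} → Agent k → Agent k
  | Kind.proc, A => Proc.map σ A
  | Kind.abs _, A => Proc.map (liftMap σ) A

/-- The free names of an agent. -/
def Agent.fn : {k : Kind G} → Agent k → Set (SName G)
  | Kind.proc, A => Proc.fn A
  | Kind.abs _, A => {x | ⟨x.1, Sum.inl x.2⟩ ∈ Proc.fn A}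

/-- The (polyadic) contexts, with holes indexed by `ι` of the kinds `κ`. Contexts are not taken
modulo `α`-conversion: their binders may capture names of the agents put in the holes. -/
inductive Ctx {ι : Type} (κ : ι → Kind G) : Kind G → Type 1
  | hole (i : ι) : Ctx κ (κ i)
  | agent {k : Kind G} (A : Agent k) : Ctx κ k
  | inp {s : G.S} (a : Name G s) (b : ∀ i, Name G (G.ob s i)) (hb : Distinct b)
      (C : Ctx κ Kind.proc) : Ctx κ Kind.proc
  | rep {s : G.S} (a : Name G s) (b : ∀ i, Name G (G.ob s i)) (hb : Distinct b)
      (C : Ctx κ Kind.proc) : Ctx κ Kind.proc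
  | par (C D : Ctx κ Kind.proc) : Ctx κ Kind.proc
  | res {s : G.S} (c : Name G s) (C : Ctx κ Kind.proc) : Ctx κ Kind.proc
  | app {s : G.S} (C : Ctx κ (Kind.abs s)) (a : Name G s) : Ctx κ Kind.proc
  | abs {s : G.S} (c : Name G s) (C : Ctx κ Kind.proc) : Ctx κ (Kind.abs s)

namespace Ctx

variable {ι ι' : Type} {κ : ι → Kind G} {κ' : ι' → Kind G}

/-- `C[A₁, …, Aₙ]`: the holes of a context are filled with agents. -/
noncomputable def fill (A : ∀ i, Agent (κ i)) : {k : Kind G} → Ctx κ k → Agent k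
  | _, hole i => A i
  | _, agent B => B
  | _, inp a b _ C => Proc.inp a (Proc.bind (C.fill A) (tuple b))
  | _, rep a b _ C => Proc.rep a (Proc.bind (C.fill A) (tuple b))
  | _, par C D => Proc.par (C.fill A) (D.fill A)
  | _, res c C => Proc.res (Proc.bind (C.fill A) (single c))
  | _, app C a => Proc.app (C.fill A) a
  | _, abs c C => Proc.bind (C.fill A) (single c)

/-- The holes of a context are filled with contexts. -/
def comp (E : ∀ i, Ctx κ' (κ i)) : {k : Kind G} → Ctx κ k → Ctx κ' k
  | _, hole i => E i
  | _, agent B => agent B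
  | _, inp a b hb C => inp a b hb (C.comp E)
  | _, rep a b hb C => rep a b hb (C.comp E)
  | _, par C D => par (C.comp E) (D.comp E)
  | _, res c C => res c (C.comp E)
  | _, app C a => app (C.comp E) a
  | _, abs c C => abs c (C.comp E)

/-- A context is guarded if all its holes are underneath a prefix. (Outputs are asynchronous, hence
only input prefixes have anything underneath.) -/
def Guarded : {k : Kind G} → Ctx κ k → Prop
  | _, hole _ => False
  | _, agent _ => True
  | _, inp _ _ _ _ => True
  | _, rep _ _ _ _ => True
  | _, par C D => C.Guarded ∧ D.Guarded
  | _, res _ C => C.Guarded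
  | _, app C _ => C.Guarded
  | _, abs _ C => C.Guarded

/-- The `i`-th hole occurs in a context. -/
def Occurs (i : ι) : {k : Kind G} → Ctx κ k → Prop
  | _, hole j => j = i
  | _, agent _ => False
  | _, inp _ _ _ C => C.Occurs i
  | _, rep _ _ _ C => C.Occurs i
  | _, par C D => C.Occurs i ∨ D.Occurs i
  | _, res _ C => C.Occurs i
  | _, app C _ => C.Occurs i
  | _, abs _ C => C.Occurs i

/-- The `i`-th hole occurs under an input in a context. -/
def OccursUnderInput (i : ι) : {k : Kind G} → Ctx κ k → Prop
  | _, hole _ => False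
  | _, agent _ => False
  | _, inp _ _ _ C => C.Occurs i
  | _, rep _ _ _ C => C.Occurs i
  | _, par C D => C.OccursUnderInput i ∨ D.OccursUnderInput i
  | _, res _ C => C.OccursUnderInput i
  | _, app C _ => C.OccursUnderInput i
  | _, abs _ C => C.OccursUnderInput i

/-- The free names of a context. -/
def fn : {k : Kind G} → Ctx κ k → Set (SName G)
  | _, hole _ => ∅
  | _, agent A => A.fn
  | _, inp a b _ C => {⟨_, a⟩} ∪ (C.fn \ Set.range (fun i => ⟨_, b i⟩))
  | _, rep a b _ C => {⟨_, a⟩} ∪ (C.fn \ Set.range (fun i => ⟨_, b i⟩))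
  | _, par C D => C.fn ∪ D.fn
  | _, res c C => C.fn \ {⟨_, c⟩}
  | _, app C a => {⟨_, a⟩} ∪ C.fn
  | _, abs c C => C.fn \ {⟨_, c⟩}

/-- Every hole of the context is in the scope of a binder for the name `x`. -/
def HolesInScopeOf (x : SName G) : {k : Kind G} → Ctx κ k → Prop
  | _, hole _ => False
  | _, agent _ => True
  | _, inp _ b _ C => x ∈ Set.range (fun i => (⟨_, b i⟩ : SName G)) ∨ C.HolesInScopeOf x
  | _, rep _ b _ C => x ∈ Set.range (fun i => (⟨_, b i⟩ : SName G)) ∨ C.HolesInScopeOf x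
  | _, par C D => C.HolesInScopeOf x ∧ D.HolesInScopeOf x
  | _, res c C => x = ⟨_, c⟩ ∨ C.HolesInScopeOf x
  | _, app C _ => C.HolesInScopeOf x
  | _, abs c C => x = ⟨_, c⟩ ∨ C.HolesInScopeOf x

end Ctx

/-- The relations on agents; only agents of the same kind are compared. -/
abbrev AgentRel (G : Sorting) : Type 1 := ∀ k : Kind G, Agent k → Agent k → Prop

/-- A relation on agents is preserved by all contexts. -/
def PreservedByContexts (R : AgentRel G) : Prop :=
  ∀ (k k' : Kind G) (C : Ctx (fun _ : Unit => k) k') (A B : Agent k),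
    R k A B → R k' (C.fill (fun _ => A)) (C.fill (fun _ => B))

/-- A precongruence: a preorder that is preserved by all contexts. -/
structure IsPrecongruence (R : AgentRel G) : Prop where
  refl : ∀ k A, R k A A
  trans : ∀ k A B C, R k A B → R k B C → R k A C
  context : PreservedByContexts R

/-- A congruence: an equivalence that is preserved by all contexts. -/
structure IsCongruence (R : AgentRel G) : Prop where
  equivalence : ∀ k, Equivalence (R k)
  context : PreservedByContexts R

/-- The requirement on a relation `R` of the up-to-`le`-and-contexts technique for `eqv`. -/
def IsUpToCandidate (eqv le : AgentRel G) (R : PiProc G → PiProc G → Prop) : Prop :=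
  ∀ P Q, R P Q → ∀ μ P', Step P μ P' → Disjoint μ.bn Q.fn →
    ∃ Q', WeakHat Q μ Q' ∧
      ∃ (n : ℕ) (C : Ctx (fun _ : Fin n => Kind.proc (G := G)) Kind.proc)
        (Ps Qs : Fin n → PiProc G),
        le Kind.proc (C.fill Ps) P' ∧ le Kind.proc (C.fill Qs) Q' ∧
        ∀ i, eqv Kind.proc (Ps i) (Qs i) ∨
          (R (Ps i) (Qs i) ∧
            (C.OccursUnderInput i →
              ∀ σ : ∀ u, Name G u → Name G u, R ((Ps i).map σ) ((Qs i).map σ)))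

/-- `eqv` validates the up-to-`le`-and-contexts technique. -/
def ValidatesUpTo (eqv le : AgentRel G) : Prop :=
  ∀ R : PiProc G → PiProc G → Prop, (∀ P Q, R P Q → R Q P) → IsUpToCandidate eqv le R →
    ∀ P Q, R P Q → eqv Kind.proc P Q

/-! # Encodings of the `λ`-calculus into the `π`-calculus -/

/-- A compositional and uniform encoding. The encoding of a `λ`-term is an abstraction whose
parameter has sort `addr`; the `λ`-variables are included, by `name`, in the names of the sort
`vs`. That `enc` respects `α`-conversion is automatic. -/
structure Encoding (G : Sorting) where
  /-- the sort of the names that represent `λ`-variables -/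
  vs : G.S
  /-- the sort of the parameter of the encoding of a `λ`-term -/
  addr : G.S
  /-- the inclusion of the `λ`-variables in the names -/
  name : ℕ → Name G vs
  name_injective : Function.Injective name
  /-- the encoding of terms -/
  enc : Term → Agent (Kind.abs addr)
  /-- the abstraction contexts -/
  lamC : ℕ → Ctx (fun _ : Unit => Kind.abs addr) (Kind.abs addr)
  /-- the application context -/
  appC : Ctx (fun _ : Fin 2 => Kind.abs addr) (Kind.abs addr)
  enc_lam : ∀ x M, enc (Term.abs x M) = (lamC x).fill (fun _ => enc M)
  enc_app : ∀ M N, enc (Term.app M N) = appC.fill ![enc M, enc N]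
  /-- in an abstraction context, `x` only appears as a bound name whose scope embraces the hole -/
  lamC_not_free : ∀ x, (⟨vs, name x⟩ : SName G) ∉ (lamC x).fn
  lamC_scope : ∀ x, (lamC x).HolesInScopeOf ⟨vs, name x⟩
  /-- the encoding commutes with the renaming `σ` of the variables, seen as a substitution on
  names -/
  uniform : ∀ (σ : ℕ → ℕ) (σ' : ∀ u, Name G u → Name G u), (∀ x, σ' vs (name x) = name (σ x)) →
    ∀ M, enc (M.rename σ) = (enc M).map σ'
  /-- the encoding does not introduce free names -/
  fn_enc : ∀ M, (enc M).fn ⊆ {a | ∃ x ∈ M.fv, a = ⟨vs, name x⟩}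

namespace Encoding

variable (E : Encoding G)

/-- The variable context `⟦x [·]₁ … [·]ₙ⟧`. -/
def varC (x : ℕ) : (n : ℕ) → Ctx (fun _ : Fin n => Kind.abs E.addr) (Kind.abs E.addr)
  | 0 => Ctx.agent (E.enc (Term.var x))
  | n + 1 => E.appC.comp
      ![(varC x n).comp (fun i => Ctx.hole (κ := fun _ : Fin (n + 1) => Kind.abs E.addr) i.castSucc),
        Ctx.hole (κ := fun _ : Fin (n + 1) => Kind.abs E.addr) (Fin.last n)]

/-- The encoding and a relation on agents validate rule `β`. -/
def ValidatesBeta (R : AgentRel G) : Prop :=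
  ∀ (x : ℕ) (M N : Term),
    R _ (E.enc (Term.app (Term.abs x M) N)) (E.enc (M.substVar x N))

/-- The encoding and a relation on agents are sound for Lévy–Longo trees. -/
def SoundLT (R : AgentRel G) : Prop :=
  ∀ M N : Term, R _ (E.enc M) (E.enc N) → LT M = LT N

/-- The encoding and a relation on agents are complete for Lévy–Longo trees. -/
def CompleteLT (R : AgentRel G) : Prop :=
  ∀ M N : Term, LT M = LT N → R _ (E.enc M) (E.enc N)

/-- The encoding and a relation on agents are fully abstract for Lévy–Longo trees. -/
def FullyAbstractLT (R : AgentRel G) : Prop :=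
  E.SoundLT R ∧ E.CompleteLT R

end Encoding

end TreesPi

/-! Compare the roots of the two equal trees. If both terms are unsolvable, the hypotheses on order
`∞`, or those on order `0` applied below the leading abstractions, give the equivalence directly
(`similarHnf_or_eqv`). Otherwise both terms have head normal forms with the same abstractions, the
same head variable, and arguments with pairwise equal trees.

In the second case, take the relation of all substitution instances of the encodings of such pairs.
It satisfies the requirement of the up-to technique (`eqv_map_of_similarHnf`). By rule `β`, the
encoding of a head normal form of `M` is below that of `M`. As `le` is an expansion, a transition of
the encoding of `M` is either a `τ` that the head normal form need not match, or a transition of the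
head normal form. In the latter case guardedness enters: the arguments are underneath prefixes of
the variable context, and remain so inside abstraction contexts, guarded or not. The head normal
form of `N` therefore makes the same transition (`GuardedRel.matches`), and `N` follows weakly. Up
to `le`, the derivatives are a common context filled with instances of encodings of arguments, and
each pair of arguments is again in the relation or already equivalent.

Two points need care. First, neither `eqv` nor `le` is assumed to be closed under name
substitutions. The context `((c)[·])⟨a⟩` performs a substitution without any transition of its own
(`exists_wrap`), and processes with the same transitions are equivalent (`eqv_of_unfolds`). Second,
an application may perform an action whose bound names include its own argument, when the parameter
does not occur in the body. Such clashes are removed by renaming (`Step.rename`,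
`Step.exists_avoid`). -/

namespace TreesPi

/-! # Renaming and substitution of `λ`-terms -/

namespace Term

theorem rename_congr {f g : ℕ → ℕ} (M : Term) (h : ∀ x ∈ M.fv, f x = g x) :
    M.rename f = M.rename g := by
  induction M generalizing f g with
  | var x => simp [rename, h x (by simp [fv])]
  | app M N ihM ihN =>
    simp only [rename]
    rw [ihM fun x hx => h x (Or.inl hx), ihN fun x hx => h x (Or.inr hx)]
  | lam M ih =>
    simp only [rename]
    rw [ih]
    rintro (_ | x) hx
    · rfl
    · simp [liftRen, h x hx]

theorem rename_id (M : Term) : M.rename id = M := by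
  have h : liftRen id = id := by funext x; cases x <;> rfl
  induction M with
  | var x => rfl
  | app M N ihM ihN => simp [rename, ihM, ihN]
  | lam M ih => simp [rename, h, ih]

theorem rename_rename (f g : ℕ → ℕ) (M : Term) :
    (M.rename f).rename g = M.rename (fun x => g (f x)) := by
  induction M generalizing f g with
  | var x => rfl
  | app M N ihM ihN => simp [rename, ihM, ihN]
  | lam M ih =>
    simp only [rename, ih]
    congr 2
    funext x
    cases x <;> rfl

theorem subst_congr {f g : ℕ → Term} (M : Term) (h : ∀ x ∈ M.fv, f x = g x) :
    M.subst f = M.subst g := by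
  induction M generalizing f g with
  | var x => simp [subst, h x (by simp [fv])]
  | app M N ihM ihN =>
    simp only [subst]
    rw [ihM fun x hx => h x (Or.inl hx), ihN fun x hx => h x (Or.inr hx)]
  | lam M ih =>
    simp only [subst]
    rw [ih]
    rintro (_ | x) hx
    · rfl
    · simp [liftSubst, h x hx]

theorem subst_rename (f : ℕ → ℕ) (g : ℕ → Term) (M : Term) :
    (M.rename f).subst g = M.subst (fun x => g (f x)) := by
  induction M generalizing f g with
  | var x => rfl
  | app M N ihM ihN => simp [rename, subst, ihM, ihN]
  | lam M ih =>
    simp only [rename, subst, ih]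
    congr 2
    funext x
    cases x <;> rfl

theorem rename_subst (f : ℕ → Term) (g : ℕ → ℕ) (M : Term) :
    (M.subst f).rename g = M.subst (fun x => (f x).rename g) := by
  induction M generalizing f g with
  | var x => rfl
  | app M N ihM ihN => simp [rename, subst, ihM, ihN]
  | lam M ih =>
    simp only [rename, subst, ih]
    congr 2
    funext x
    cases x with
    | zero => rfl
    | succ x => simp [liftSubst, rename_rename, liftRen]

theorem inst_rename (M N : Term) (g : ℕ → ℕ) :
    (M.inst N).rename g = (M.rename (liftRen g)).inst (N.rename g) := by
  simp only [inst, rename_subst, subst_rename]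
  congr 1
  funext x
  cases x <;> rfl

theorem fv_finite (M : Term) : M.fv.Finite := by
  induction M with
  | var x => exact Set.finite_singleton x
  | app M N ihM ihN => exact ihM.union ihN
  | lam M ih => exact ih.preimage (Nat.succ_injective.injOn)

/-- The renaming that opens a binder with the name `x`. -/
def openRen (x : ℕ) : ℕ → ℕ
  | 0 => x
  | y + 1 => y

/-- Bridge between the de Bruijn binder and the named binder in which the clauses of an encoding and
rule `β` are phrased; freshness of `x` ensures that closing again captures nothing else. -/
theorem abs_openRen {x : ℕ} {M : Term} (h : x ∉ (lam M).fv) :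
    abs x (M.rename (openRen x)) = lam M := by
  simp only [abs, rename_rename]
  congr 1
  conv_rhs => rw [← rename_id M]
  apply rename_congr
  rintro (_ | y) hy
  · simp [openRen]
  · have : y ≠ x := by rintro rfl; exact h hy
    simp [openRen, this]

theorem substVar_openRen {x : ℕ} {M : Term} (h : x ∉ (lam M).fv) (N : Term) :
    (M.rename (openRen x)).substVar x N = M.inst N := by
  simp only [substVar, inst, subst_rename]
  apply subst_congr
  rintro (_ | y) hy
  · simp [openRen]
  · have : y ≠ x := by rintro rfl; exact h hy
    simp [openRen, this]

theorem apps_rename (M : Term) (Ns : List Term) (g : ℕ → ℕ) :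
    (apps M Ns).rename g = apps (M.rename g) (Ns.map (rename g)) := by
  induction Ns generalizing M with
  | nil => rfl
  | cons N Ns ih => exact ih (M.app N)

/-! ## Head reduction under abstractions -/

theorem HeadRed.lams {M M' : Term} (h : HeadRed M M') (n : ℕ) :
    HeadRed (Term.lams n M) (Term.lams n M') := by
  induction n with
  | zero => exact h
  | succ n ih => exact ih.lift Term.lam fun _ _ => HeadStep.lam

theorem lams_lams (m n : ℕ) (M : Term) : lams m (lams n M) = lams (m + n) M := by
  induction m with
  | zero => simp [lams]
  | succ m ih => rw [Nat.succ_add]; simp [lams, ih]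

theorem Uncovers.mono {M : Term} {m n : ℕ} (h : M.Uncovers n) (hm : m ≤ n) : M.Uncovers m := by
  obtain ⟨M', h⟩ := h
  obtain ⟨k, rfl⟩ := Nat.exists_eq_add_of_le hm
  exact ⟨lams k M', by rwa [lams_lams]⟩

/-- Stop head reduction at the maximal number of abstractions. A head normal form or a further
abstraction of the body would give one of `M`, against unsolvability or maximality. -/
theorem UnsolvableOfOrder.exists_lams {M : Term} {n : ℕ} (h : M.UnsolvableOfOrder n) :
    ∃ M', HeadRed M (Term.lams n M') ∧ M'.UnsolvableOfOrder 0 := by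
  obtain ⟨hs, ⟨M', hM'⟩, hub⟩ := h
  refine ⟨M', hM', ?_, ⟨M', .refl⟩, ?_⟩
  · rintro ⟨m, y, Ms, hnf⟩
    refine hs ⟨n + m, y, Ms, ?_⟩
    rw [HasHnf, ← lams_lams]
    exact hM'.trans (HeadRed.lams hnf n)
  · rintro m ⟨N, hN⟩
    have : n + m ≤ n := hub ⟨N, by rw [← lams_lams]; exact hM'.trans (HeadRed.lams hN n)⟩
    omega

/-- The numbers of abstractions that `M` uncovers form a nonempty downward closed set. If it misses
some `n` it is bounded, and its supremum is a finite order. -/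
theorem unsolvableOfOrderInf_of_not {M : Term} (hs : ¬ M.Solvable)
    (h : ¬ ∃ n, M.UnsolvableOfOrder n) : M.UnsolvableOfOrderInf := by
  refine ⟨hs, fun n => ?_⟩
  by_contra hn
  have hb : BddAbove {m | M.Uncovers m} :=
    ⟨n, fun m hm => by by_contra hlt; exact hn (Uncovers.mono hm (by omega))⟩
  have hne : {m | M.Uncovers m}.Nonempty := ⟨0, M, .refl⟩
  exact h ⟨sSup {m | M.Uncovers m}, hs, Nat.sSup_mem hne hb, fun m hm => le_csSup hb hm⟩

/-! ### Reading the root off a Lévy–Longo tree -/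

/-- `M` and `N` have head normal forms that agree up to subterms with the same tree. -/
def SimilarHnf (M N : Term) : Prop :=
  ∃ (n y k : ℕ) (f g : Fin k → Term), M.HasHnf n y (List.ofFn f) ∧ N.HasHnf n y (List.ofFn g) ∧
    ∀ i, LT (f i) = LT (g i)

/-- The three ways in which two terms can have the same Lévy–Longo tree. -/
theorem cases_of_LT_eq {M N : Term} (h : LT M = LT N) :
    SimilarHnf M N ∨ (∃ n, M.UnsolvableOfOrder n ∧ N.UnsolvableOfOrder n) ∨
      (M.UnsolvableOfOrderInf ∧ N.UnsolvableOfOrderInf) := by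
  have h' := congrArg PFunctor.M.dest h
  -- Unfolding the corecursion once exhibits the root. The tree is built from a chosen head normal
  -- form, and that same one is returned, so uniqueness of head normal forms plays no role.
  have key : ∀ M : Term,
      (∃ n y Ms, M.HasHnf n y Ms ∧ PFunctor.M.dest (LT M) =
        ⟨LTLabel.node n y Ms.length, fun i : Fin Ms.length => LT (Ms.get i)⟩) ∨
      (∃ n, M.UnsolvableOfOrder n ∧ ∃ f, PFunctor.M.dest (LT M) = ⟨LTLabel.bot n, f⟩) ∨
      (M.UnsolvableOfOrderInf ∧ ∃ f, PFunctor.M.dest (LT M) = ⟨LTLabel.top, f⟩) := by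
    intro M
    have hd : PFunctor.M.dest (LT M) = LTFunctor.map LT (ltStep M) :=
      PFunctor.M.dest_corec ltStep M
    by_cases h1 : ∃ r : ℕ × ℕ × List Term, M.HasHnf r.1 r.2.1 r.2.2
    · exact Or.inl ⟨_, _, _, h1.choose_spec,
        hd.trans (congrArg (LTFunctor.map LT) (dif_pos h1))⟩
    by_cases h2 : ∃ n, M.UnsolvableOfOrder n
    · have e : ltStep M = ⟨LTLabel.bot h2.choose, Empty.elim⟩ := by
        unfold ltStep
        exact (dif_neg h1).trans (dif_pos h2)
      exact Or.inr (Or.inl ⟨_, h2.choose_spec, _, hd.trans (congrArg (LTFunctor.map LT) e)⟩)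
    · have e : ltStep M = ⟨LTLabel.top, Empty.elim⟩ := by
        unfold ltStep
        exact (dif_neg h1).trans (dif_neg h2)
      refine Or.inr (Or.inr ⟨unsolvableOfOrderInf_of_not ?_ h2, _,
        hd.trans (congrArg (LTFunctor.map LT) e)⟩)
      rintro ⟨n, y, Ms, hnf⟩
      exact h1 ⟨(n, y, Ms), hnf⟩
  rcases key M with ⟨n, y, Ms, hM, eM⟩ | ⟨n, hM, f, eM⟩ | ⟨hM, f, eM⟩ <;>
    rcases key N with ⟨m, z, Ns, hN, eN⟩ | ⟨m, hN, g, eN⟩ | ⟨hN, g, eN⟩ <;>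
    rw [eM, eN] at h' <;> have hl := congrArg Sigma.fst h' <;> try (simp at hl; done)
  · obtain ⟨rfl, rfl, hlen⟩ := LTLabel.node.inj hl
    have hf : List.ofFn (fun i => Ms.get i) = Ms := List.ofFn_get Ms
    -- The two lists have lengths that are only propositionally equal; generalizing one of them to a
    -- variable `k` lets the dependent equality of children be eliminated.
    have hg : ∀ (k : ℕ) (hk : k = Ns.length),
        List.ofFn (fun i : Fin k => Ns.get (i.cast hk)) = Ns := by
      rintro _ rfl
      exact List.ofFn_get Ns
    have hs : ∀ (k : ℕ) (hk : k = Ns.length) (f : Fin k → LTree),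
        (⟨LTLabel.node n y k, f⟩ : LTFunctor.Obj LTree) =
          ⟨LTLabel.node n y Ns.length, fun i : Fin Ns.length => LT (Ns.get i)⟩ →
        ∀ i : Fin k, f i = LT (Ns.get (i.cast hk)) := by
      rintro k rfl f hf i
      have := eq_of_heq (Sigma.mk.inj hf).2
      exact congrFun this i
    exact Or.inl ⟨n, y, Ms.length, fun i => Ms.get i, fun i => Ns.get (i.cast hlen),
      by rwa [hf], by rwa [hg], hs _ hlen _ h'⟩
  · obtain rfl := LTLabel.bot.inj hl
    exact Or.inr (Or.inl ⟨n, hM, hN⟩)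
  · exact Or.inr (Or.inr ⟨hM, hN⟩)

end Term
end TreesPi

namespace TreesPi

/-! # Substitution of names in processes -/

variable {G : Sorting}

/-- A substitution as a function on sorted names. -/
def sig {X Y : G.S → Type} (f : ∀ u, X u → Y u) (x : Σ u, X u) : Σ u, Y u := ⟨x.1, f x.1 x.2⟩

theorem sig_injective {X Y : G.S → Type} {f : ∀ u, X u → Y u}
    (hf : ∀ u, Function.Injective (f u)) : Function.Injective (sig f) := by
  rintro ⟨u, x⟩ ⟨v, y⟩ h
  obtain rfl : u = v := congrArg Sigma.fst h
  exact congrArg _ (hf u (eq_of_heq (Sigma.mk.inj h).2))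

theorem eq_of_sig_eq {X : G.S → Type} {f : ∀ u, X u → X u} {u : G.S} {x : X u}
    (h : sig f ⟨u, x⟩ = ⟨u, x⟩) : f u x = x := eq_of_heq (Sigma.mk.inj h).2

namespace Proc

variable {X Y Z B : G.S → Type}

theorem map_congr (P : Proc X) {Y : G.S → Type} {f g : ∀ u, X u → Y u}
    (h : ∀ u x, (⟨u, x⟩ : Σ u, X u) ∈ P.fn → f u x = g u x) : P.map f = P.map g := by
  have lift : ∀ {X Y B : G.S → Type} {f g : ∀ u, X u → Y u} (P : Proc (Ext X B)),
      (∀ u x, (⟨u, Sum.inl x⟩ : Σ u, Ext X B u) ∈ P.fn → f u x = g u x) →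
      ∀ u x, (⟨u, x⟩ : Σ u, Ext X B u) ∈ P.fn → liftMap f u x = liftMap g u x := by
    rintro X Y B f g P h u (x | x) hx
    · simp [liftMap, h u x hx]
    · rfl
  induction P generalizing Y with
  | nil => rfl
  | inp a P ih =>
    simp only [map]
    rw [h _ a (Or.inl rfl), ih (lift P fun u x hx => h u x (Or.inr hx))]
  | out a b =>
    simp only [map]
    rw [h _ a (Or.inl rfl)]
    congr 1
    funext i
    exact h _ _ (Or.inr ⟨i, rfl⟩)
  | par P Q ihP ihQ =>
    simp only [map]
    rw [ihP fun u x hx => h u x (Or.inl hx), ihQ fun u x hx => h u x (Or.inr hx)]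
  | res P ih =>
    simp only [map]
    rw [ih (lift P fun u x hx => h u x hx)]
  | rep a P ih =>
    simp only [map]
    rw [h _ a (Or.inl rfl), ih (lift P fun u x hx => h u x (Or.inr hx))]
  | app P a ih =>
    simp only [map]
    rw [h _ a (Or.inl rfl), ih (lift P fun u x hx => h u x (Or.inr hx))]

theorem map_id (P : Proc X) : P.map (fun _ x => x) = P := by
  have h : ∀ {X B : G.S → Type}, liftMap (B := B) (fun u (x : X u) => x) = fun _ x => x := by
    intro X B; funext u x; cases x <;> rfl
  induction P with
  | nil => rfl
  | out a b => rfl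
  | par P Q ihP ihQ => simp [map, ihP, ihQ]
  | _ => simp only [map, *]

theorem map_eq_self {P : Proc X} {f : ∀ u, X u → X u}
    (h : ∀ u x, (⟨u, x⟩ : Σ u, X u) ∈ P.fn → f u x = x) : P.map f = P := by
  conv_rhs => rw [← map_id P]
  exact map_congr P h

theorem map_map (P : Proc X) {Y Z : G.S → Type} (f : ∀ u, X u → Y u) (g : ∀ u, Y u → Z u) :
    (P.map f).map g = P.map (fun u x => g u (f u x)) := by
  have h : ∀ {X Y Z B : G.S → Type} (f : ∀ u, X u → Y u) (g : ∀ u, Y u → Z u),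
      (fun u x => liftMap (B := B) g u (liftMap f u x)) = liftMap (fun u x => g u (f u x)) := by
    intro X Y Z B f g; funext u x; cases x <;> rfl
  induction P generalizing Y Z with
  | nil => rfl
  | out a b => rfl
  | par P Q ihP ihQ => simp [map, ihP, ihQ]
  | _ => simp only [map, *]

theorem fn_map (P : Proc X) {Y : G.S → Type} (f : ∀ u, X u → Y u) :
    (P.map f).fn = sig f '' P.fn := by
  have lift : ∀ {X Y B : G.S → Type} (f : ∀ u, X u → Y u) (S : Set (Σ u, Ext X B u)),
      {y : Σ u, Y u | (⟨y.1, Sum.inl y.2⟩ : Σ u, Ext Y B u) ∈ sig (liftMap f) '' S} =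
        sig f '' {x | (⟨x.1, Sum.inl x.2⟩ : Σ u, Ext X B u) ∈ S} := by
    intro X Y B f S
    ext ⟨u, y⟩
    constructor
    · rintro ⟨⟨v, x | x⟩, hx, e⟩
      · obtain rfl : v = u := congrArg Sigma.fst e
        refine ⟨⟨v, x⟩, hx, ?_⟩
        have := eq_of_heq (Sigma.mk.inj e).2
        simp only [liftMap, Sum.map_inl, Sum.inl.injEq] at this
        simp [sig, this]
      · obtain rfl : v = u := congrArg Sigma.fst e
        have := eq_of_heq (Sigma.mk.inj e).2
        simp [liftMap] at this
    · rintro ⟨⟨v, x⟩, hx, e⟩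
      obtain rfl : v = u := congrArg Sigma.fst e
      have := eq_of_heq (Sigma.mk.inj e).2
      exact ⟨⟨v, Sum.inl x⟩, hx, by simp only [sig] at this ⊢; simp [liftMap, ← this]⟩
  induction P generalizing Y with
  | nil => simp [map, fn]
  | out a b =>
    simp only [map, fn, Set.image_union, Set.image_singleton]
    congr 1
    rw [← Set.range_comp]
    rfl
  | par P Q ihP ihQ => simp [map, fn, ihP, ihQ, Set.image_union]
  | res P ih => simp only [map, fn, ih, lift]
  | inp a P ih => simp only [map, fn, ih, lift, Set.image_union, Set.image_singleton]; rfl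
  | rep a P ih => simp only [map, fn, ih, lift, Set.image_union, Set.image_singleton]; rfl
  | app P a ih => simp only [map, fn, ih, lift, Set.image_union, Set.image_singleton]; rfl

theorem fn_finite (P : Proc X) : P.fn.Finite := by
  have lift : ∀ {X B : G.S → Type} {S : Set (Σ u, Ext X B u)}, S.Finite →
      {x : Σ u, X u | (⟨x.1, Sum.inl x.2⟩ : Σ u, Ext X B u) ∈ S}.Finite := by
    intro X B S hS
    refine hS.preimage (Function.Injective.injOn ?_)
    exact sig_injective (f := fun u x => Sum.inl x) fun u => Sum.inl_injective
  induction P with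
  | nil => exact Set.finite_empty
  | out a b => exact (Set.finite_singleton _).union (Set.finite_range _)
  | par P Q ihP ihQ => exact ihP.union ihQ
  | res P ih => exact lift ih
  | inp a P ih => exact (Set.finite_singleton _).union (lift ih)
  | rep a P ih => exact (Set.finite_singleton _).union (lift ih)
  | app P a ih => exact (Set.finite_singleton _).union (lift ih)

theorem map_inst (P : Proc (Ext X B)) (β : ∀ u, B u → X u) (f : ∀ u, X u → Y u) :
    (P.inst β).map f = (P.map (liftMap f)).inst (fun u b => f u (β u b)) := by
  simp only [inst, map_map]
  congr 1
  funext u x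
  cases x <;> rfl

theorem inst_map_liftMap (P : Proc (Ext X B)) (f : ∀ u, X u → Y u) (β : ∀ u, B u → Y u) :
    (P.map (liftMap f)).inst β = P.map (fun u => Sum.elim (f u) (β u)) := by
  simp only [inst, map_map]
  congr 1
  funext u x
  cases x <;> rfl

/-- Injectivity is essential: otherwise `f` could identify a free name with one that is about to be
bound. -/
theorem map_bind (P : Proc X) (β : ∀ u, B u → X u) {f : ∀ u, X u → Y u}
    (hf : ∀ u, Function.Injective (f u)) :
    (P.bind β).map (liftMap f) = (P.map f).bind (fun u b => f u (β u b)) := by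
  simp only [bind, map_map]
  congr 1
  funext u x
  have hp : (fun i => f u (β u i) = f u x) = fun i => β u i = x :=
    funext fun i => propext (hf u).eq_iff
  by_cases h : ∃ i, β u i = x
  · have h' : ∃ i, f u (β u i) = f u x := by rwa [hp]
    rw [dif_pos h, dif_pos h']
    have : ∀ {p q : B u → Prop} (hp : ∃ i, p i) (hq : ∃ i, q i), p = q →
        hp.choose = hq.choose := by rintro p _ hp hq rfl; rfl
    exact congrArg Sum.inr (this h h' hp.symm)
  · have h' : ¬ ∃ i, f u (β u i) = f u x := by rwa [hp]
    rw [dif_neg h, dif_neg h']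
    rfl

/-- Opening a binder with distinct fresh names and closing it again is the identity. -/
theorem bind_inst {P : Proc (Ext X B)} {β : ∀ u, B u → X u}
    (hβ : ∀ u, Function.Injective (β u))
    (h : ∀ u i, (⟨u, Sum.inl (β u i)⟩ : Σ u, Ext X B u) ∉ P.fn) : (P.inst β).bind β = P := by
  simp only [bind, inst, map_map]
  apply map_eq_self
  rintro u (x | i) hx
  · have : ¬ ∃ i, β u i = x := by rintro ⟨i, rfl⟩; exact h u i hx
    simp [this]
  · have : ∃ j, β u j = β u i := ⟨i, rfl⟩
    exact (dif_pos this).trans (congrArg Sum.inr (hβ u this.choose_spec))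

theorem mem_fn_inst {P : Proc (Ext X B)} {β : ∀ u, B u → X u} {x : Σ u, X u}
    (h : x ∈ (P.inst β).fn) :
    (⟨x.1, Sum.inl x.2⟩ : Σ u, Ext X B u) ∈ P.fn ∨ ∃ i : B x.1, x.2 = β x.1 i := by
  rw [inst, fn_map] at h
  obtain ⟨⟨u, y | i⟩, hy, rfl⟩ := h
  · exact Or.inl hy
  · exact Or.inr ⟨i, rfl⟩

theorem fn_bind (P : Proc X) (β : ∀ u, B u → X u) {x : Σ u, X u} :
    (⟨x.1, Sum.inl x.2⟩ : Σ u, Ext X B u) ∈ (P.bind β).fn ↔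
      x ∈ P.fn ∧ ∀ i, β x.1 i ≠ x.2 := by
  rw [bind, fn_map]
  constructor
  · rintro ⟨⟨u, y⟩, hy, e⟩
    obtain ⟨v, x⟩ := x
    obtain rfl : u = v := congrArg Sigma.fst e
    have := eq_of_heq (Sigma.mk.inj e).2
    dsimp only at this
    split_ifs at this with h
    obtain rfl := Sum.inl.inj this
    exact ⟨hy, fun i hi => h ⟨i, hi⟩⟩
  · rintro ⟨hx, h⟩
    refine ⟨x, hx, ?_⟩
    have : ¬ ∃ i, β x.1 i = x.2 := fun ⟨i, hi⟩ => h i hi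
    simp [sig, this]

end Proc

theorem map_single {X Y : G.S → Type} {s : G.S} (c : X s) (f : ∀ u, X u → Y u) :
    (fun u i => f u (single c u i)) = single (f s c) := by
  funext u ⟨h⟩
  subst h
  rfl

theorem map_tuple {X Y : G.S → Type} {s : G.S} (b : ∀ i, X (G.ob s i)) (f : ∀ u, X u → Y u) :
    (fun u i => f u (tuple b u i)) = tuple (fun i => f _ (b i)) := by
  funext u ⟨i, h⟩
  subst h
  rfl

theorem single_injective {X : G.S → Type} {s : G.S} (c : X s) (u : G.S) :
    Function.Injective (single c u) := fun _ _ _ => Subsingleton.elim _ _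

theorem Distinct.tuple_injective {s : G.S} {b : ∀ i, Name G (G.ob s i)} (hb : Distinct b)
    (u : G.S) : Function.Injective (tuple (X := Name G) b u) := by
  rintro ⟨i, rfl⟩ ⟨j, h⟩ e
  refine Subtype.ext (hb ?_)
  have : ∀ (u : G.S) (h : G.ob s j = u) (y : Name G u),
      y = tuple (X := Name G) b u ⟨j, h⟩ → (⟨u, y⟩ : SName G) = ⟨G.ob s j, b j⟩ := by
    rintro u rfl y rfl
    rfl
  exact this _ h _ e

theorem sigma_single {X : G.S → Type} {s : G.S} (c : X s) (u : G.S) (i : One s u) :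
    (⟨u, single c u i⟩ : Σ u, X u) = ⟨s, c⟩ := by
  obtain ⟨rfl⟩ := i
  rfl

theorem sigma_tuple {X : G.S → Type} {s : G.S} (b : ∀ i, X (G.ob s i)) (u : G.S)
    (i : Par s u) : (⟨u, tuple b u i⟩ : Σ u, X u) = ⟨_, b i.1⟩ := by
  obtain ⟨i, rfl⟩ := i
  rfl

/-! ## Fresh names -/

theorem exists_bound {W : Set (SName G)} (hW : W.Finite) : ∃ N : ℕ, ∀ x ∈ W, x.2 < N := by
  obtain ⟨N, hN⟩ := (hW.image (fun x : SName G => (x.2 : ℕ))).bddAbove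
  exact ⟨N + 1, fun x hx => Nat.lt_succ_of_le (hN ⟨x, hx, rfl⟩)⟩

theorem exists_fresh {W : Set (SName G)} (hW : W.Finite) (s : G.S) :
    ∃ c : Name G s, (⟨s, c⟩ : SName G) ∉ W := by
  obtain ⟨N, hN⟩ := exists_bound hW
  exact ⟨N, fun h => lt_irrefl _ (hN _ h)⟩

theorem exists_fresh_tuple {W : Set (SName G)} (hW : W.Finite) (s : G.S) :
    ∃ b : ∀ i, Name G (G.ob s i), Distinct b ∧ ∀ i, (⟨_, b i⟩ : SName G) ∉ W := by
  obtain ⟨N, hN⟩ := exists_bound hW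
  refine ⟨fun i => (N + i.1 : ℕ), fun i j h => ?_, fun i h => ?_⟩
  · have h' : N + i.1 = N + j.1 := congrArg (fun z : SName G => (z.2 : ℕ)) h
    exact Fin.ext (Nat.add_left_cancel h')
  · have h' : N + i.1 < N := hN _ h
    omega

/-- Every finite set `D` of names can be moved away from a finite set `W` by an injective renaming
whose image avoids `D`, and that does not affect the other elements of `W`. -/
theorem exists_move {D W : Set (SName G)} (hD : D.Finite) (hW : W.Finite) :
    ∃ π : ∀ u, Name G u → Name G u, (∀ u, Function.Injective (π u)) ∧
      (∀ x ∈ D, sig π x ∉ W) ∧ (∀ x, sig π x ∉ D) ∧ ∀ x ∈ W, x ∉ D → sig π x = x := by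
  classical
  obtain ⟨N, hN⟩ := exists_bound (hD.union hW)
  have inj : ∀ p : ℕ → Prop, Function.Injective (fun n => if n < N ∧ ¬ p n then n else n + N) := by
    intro p m n h
    dsimp only at h
    split_ifs at h <;> omega
  -- With `N` above all names of `D` and `W`, the names below `N` outside `D` stay and all others
  -- are shifted by `N`. Shifted names are at least `N`, hence differ from the fixed ones and lie
  -- outside both `D` and `W`.
  refine ⟨fun u (n : ℕ) => if n < N ∧ (⟨u, n⟩ : SName G) ∉ D then n else n + N,
    fun u => inj fun n => (⟨u, n⟩ : SName G) ∈ D, ?_, ?_, ?_⟩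
  · rintro ⟨u, n⟩ hx h
    simp only [sig, hx, not_true, and_false, if_false] at h
    exact absurd (hN _ (Or.inr h)) (not_lt.2 (Nat.le_add_left N n))
  · rintro ⟨u, n⟩ h
    simp only [sig] at h
    split_ifs at h with hn
    · exact hn.2 h
    · exact absurd (hN _ (Or.inl h)) (not_lt.2 (Nat.le_add_left N n))
  · rintro ⟨u, n⟩ hx hD
    have : (n : ℕ) < N := hN ⟨u, n⟩ (Or.inr hx)
    simp [sig, hD, this]

/-! # Transitions under injective renamings -/

/-- The substitution of names in an action. -/
def Act.map (f : ∀ u, Name G u → Name G u) : Act G → Act G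
  | tau => tau
  | inp a b => inp (f _ a) (fun i => f _ (b i))
  | out D a b => out (sig f '' D) (f _ a) (fun i => f _ (b i))

theorem Act.bn_map (f : ∀ u, Name G u → Name G u) (μ : Act G) :
    (μ.map f).bn = sig f '' μ.bn := by
  cases μ with
  | tau => simp [map, bn]
  | inp a b =>
    simp only [map, bn]
    rw [← Set.range_comp]
    rfl
  | out D a b => rfl

theorem Act.names_map (f : ∀ u, Name G u → Name G u) (μ : Act G) :
    (μ.map f).names = sig f '' μ.names := by
  cases μ with
  | tau => simp [map, names]
  | inp a b =>
    simp only [map, names, Set.image_union, Set.image_singleton]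
    rw [← Set.range_comp]
    rfl
  | out D a b =>
    simp only [map, names, Set.image_union, Set.image_singleton]
    rw [← Set.range_comp]
    rfl

theorem Act.bn_subset_names (μ : Act G) : μ.bn ⊆ μ.names := by
  cases μ with
  | tau => exact subset_rfl
  | inp a b => exact Set.subset_union_right
  | out D a b => exact Set.subset_union_right

section

variable {f : ∀ u, Name G u → Name G u}

theorem Proc.map_nu (hf : ∀ u, Function.Injective (f u)) {s : G.S} (c : Name G s) (P : PiProc G) :
    (Proc.nu c P).map f = Proc.nu (f s c) (P.map f) := by
  simp only [Proc.nu, Proc.map, Proc.map_bind _ _ hf, map_single]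

theorem Proc.map_nus (hf : ∀ u, Function.Injective (f u)) (d : List (SName G)) (P : PiProc G) :
    (Proc.nus d P).map f = Proc.nus (d.map (sig f)) (P.map f) := by
  induction d with
  | nil => rfl
  | cons c d ih =>
    simp only [Proc.nus, Proc.map_nu hf, ih, List.map_cons]
    rfl

theorem Proc.map_substTuple (hf : ∀ u, Function.Injective (f u)) {s : G.S} (P : PiProc G)
    (b c : ∀ i, Name G (G.ob s i)) :
    (P.substTuple b c).map f =
      (P.map f).substTuple (fun i => f _ (b i)) (fun i => f _ (c i)) := by
  simp only [Proc.substTuple, Proc.map_inst, Proc.map_bind _ _ hf, map_tuple]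

theorem disjoint_map_fn (hf : ∀ u, Function.Injective (f u)) {μ : Act G} {P : PiProc G}
    (h : Disjoint μ.bn P.fn) : Disjoint (μ.map f).bn (P.map f).fn := by
  rw [Act.bn_map, Proc.fn_map]
  exact (Set.disjoint_image_iff (sig_injective hf)).2 h

/-- An injective renaming commutes with binding and preserves every freshness side condition, so
each rule is mapped to an instance of itself. -/
theorem Step.map (hf : ∀ u, Function.Injective (f u)) {P P' : PiProc G} {μ : Act G}
    (h : Step P μ P') : Step (P.map f) (μ.map f) (P'.map f) := by
  have hs : Function.Injective (sig f) := sig_injective hf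
  have hD : ∀ {s : G.S} {b : ∀ i, Name G (G.ob s i)}, Distinct b →
      Distinct (fun i => f _ (b i)) := fun hb i j h => hb (hs h)
  have hd : ∀ {d : List (SName G)} {D : Set (SName G)}, {x | x ∈ d} = D →
      {x | x ∈ d.map (sig f)} = sig f '' D := by
    rintro d D rfl
    ext x
    simp
  induction h with
  | inp a P b hb hfr =>
    rw [Proc.map_inst, map_tuple]
    exact Step.inp _ _ _ (hD hb) (disjoint_map_fn (f := f) (P := Proc.inp a P) hf hfr)
  | rep a P b hb hfr =>
    simp only [Proc.map]
    rw [Proc.map_inst, map_tuple]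
    exact Step.rep _ _ _ (hD hb) (disjoint_map_fn (f := f) (P := Proc.rep a P) hf hfr)
  | out a b =>
    simp only [Act.map, Set.image_empty]
    exact Step.out _ _
  | parL Q _ hfr ih => exact Step.parL _ ih (disjoint_map_fn hf hfr)
  | parR P _ hfr ih => exact Step.parR _ ih (disjoint_map_fn hf hfr)
  | comL d _ _ hfr hn he ih₁ ih₂ =>
    rw [Proc.map_nus hf]
    simp only [Proc.map]
    rw [Proc.map_substTuple hf]
    refine Step.comL _ ih₁ ih₂ ?_ (hn.map hs) (hd he)
    rw [Proc.fn_map]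
    exact (Set.disjoint_image_iff hs).2 hfr
  | comR d _ _ hfr hn he ih₁ ih₂ =>
    rw [Proc.map_nus hf]
    simp only [Proc.map]
    rw [Proc.map_substTuple hf]
    refine Step.comR _ ih₁ ih₂ ?_ (hn.map hs) (hd he)
    rw [Proc.fn_map]
    exact (Set.disjoint_image_iff hs).2 hfr
  | @res s P P' μ c hc _ hμ ih =>
    rw [Proc.map_nu hf]
    rw [Proc.map_inst, map_single] at ih
    refine Step.res _ ?_ ih ?_
    · intro h
      have h' : sig f ⟨s, c⟩ ∈ ((Proc.res P).map f).fn := h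
      rw [Proc.fn_map] at h'
      exact hc (hs.mem_set_image.1 h')
    · rw [Act.names_map]
      exact fun h => hμ (hs.mem_set_image.1 h)
  | @opn s t P P' D a b c hc _ hb hD hne ih =>
    rw [Proc.map_inst, map_single] at ih
    simp only [Act.map, Set.image_insert_eq]
    refine Step.opn _ ?_ ih ?_ ?_ ?_
    · intro h
      have h' : sig f ⟨s, c⟩ ∈ ((Proc.res P).map f).fn := h
      rw [Proc.fn_map] at h'
      exact hc (hs.mem_set_image.1 h')
    · obtain ⟨i, hi⟩ := hb
      exact ⟨i, congrArg (sig f) hi⟩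
    · exact fun h => hD (hs.mem_set_image.1 h)
    · exact fun h => hne (hs h)
  | app b _ ih =>
    rw [Proc.map_inst, map_single] at ih
    exact Step.app _ ih

end

/-! ### Bound names of transitions and their renaming -/

theorem Step.names_finite {P P' : PiProc G} {μ : Act G} (h : Step P μ P') : μ.names.Finite := by
  have hr : ∀ {s : G.S} (b : ∀ i, Name G (G.ob s i)),
      (Set.range (fun i => (⟨_, b i⟩ : SName G))).Finite := fun b => Set.finite_range _
  induction h with
  | inp a P b => exact (Set.finite_singleton _).union (hr b)
  | rep a P b => exact (Set.finite_singleton _).union (hr b)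
  | out a b => exact ((Set.finite_singleton _).union (hr b)).union Set.finite_empty
  | comL => exact Set.finite_empty
  | comR => exact Set.finite_empty
  | opn c _ _ _ _ _ ih =>
    refine (ih.insert ⟨_, c⟩).subset ?_
    rintro x (hx | (rfl | hx))
    · exact Or.inr (Or.inl hx)
    · exact Or.inl rfl
    · exact Or.inr (Or.inr hx)
  | _ => assumption

/-- The subject of an action is not among its bound names. -/
def Act.SubjectFree : Act G → Prop
  | tau => True
  | inp a b => (⟨_, a⟩ : SName G) ∉ (Act.inp a b).bn
  | out D a _ => (⟨_, a⟩ : SName G) ∉ D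

/-- This allows the bound names of an action to be renamed while its subject stays fixed, as is
needed to keep two communicating actions complementary. -/
theorem Step.subjectFree {P P' : PiProc G} {μ : Act G} (h : Step P μ P') : μ.SubjectFree := by
  induction h with
  | inp _ _ _ _ h => exact fun hm => Set.disjoint_left.1 h hm (Or.inl rfl)
  | rep _ _ _ _ h => exact fun hm => Set.disjoint_left.1 h hm (Or.inl rfl)
  | out => exact Set.notMem_empty _
  | comL => trivial
  | comR => trivial
  | opn c _ _ _ _ hne ih =>
    rintro (h | h)
    · exact hne h
    · exact ih h
  | _ => assumption


theorem Proc.fn_inst_single_subset {s : G.S} (P : Proc (Ext (Name G) (One s))) (c : Name G s) :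
    (P.inst (single c)).fn ⊆ insert ⟨s, c⟩ (Proc.res P).fn := by
  rintro ⟨u, x⟩ hx
  rcases Proc.mem_fn_inst hx with h | ⟨i, h⟩
  · exact Or.inr h
  · left
    dsimp only at h
    rw [h]
    exact sigma_single c u i

theorem Proc.fn_inst_subset_app {s : G.S} (P : Proc (Ext (Name G) (One s))) (c : Name G s) :
    (P.inst (single c)).fn ⊆ (Proc.app P c).fn := Proc.fn_inst_single_subset P c

/-- The substitution that behaves as `f` except that it maps `c` to `d`. -/
noncomputable def updateName (f : ∀ u, Name G u → Name G u) {s : G.S} (c d : Name G s) :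
    ∀ u, Name G u → Name G u :=
  open Classical in fun u x => if (⟨u, x⟩ : SName G) = ⟨s, c⟩ then d else f u x

theorem updateName_self (f : ∀ u, Name G u → Name G u) {s : G.S} (c d : Name G s) :
    updateName f c d s c = d := by
  rw [updateName, if_pos rfl]

theorem updateName_of_ne (f : ∀ u, Name G u → Name G u) {s : G.S} {c : Name G s} (d : Name G s)
    {u : G.S} {x : Name G u} (h : (⟨u, x⟩ : SName G) ≠ ⟨s, c⟩) :
    updateName f c d u x = f u x := by
  rw [updateName, if_neg h]

theorem sig_updateName_self (f : ∀ u, Name G u → Name G u) {s : G.S} (c d : Name G s) :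
    sig (updateName f c d) ⟨s, c⟩ = ⟨s, d⟩ := by rw [sig, updateName_self]

theorem sig_updateName_of_ne (f : ∀ u, Name G u → Name G u) {s : G.S} {c : Name G s}
    (d : Name G s) {x : SName G} (h : x ≠ ⟨s, c⟩) : sig (updateName f c d) x = sig f x := by
  rw [sig, updateName_of_ne f d h, sig]

theorem Proc.map_inst_updateName {s : G.S} {P : Proc (Ext (Name G) (One s))} {c : Name G s}
    (hc : (⟨s, c⟩ : SName G) ∉ (Proc.res P).fn) (ρ : ∀ u, Name G u → Name G u) (d : Name G s) :
    (P.inst (single c)).map (updateName ρ c d) = (P.map (liftMap ρ)).inst (single d) := by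
  rw [Proc.map_inst, map_single, updateName_self]
  congr 1
  apply Proc.map_congr
  rintro u (x | x) hx
  · simp only [liftMap, Sum.map_inl]
    rw [updateName_of_ne]
    intro h
    exact hc (h ▸ hx)
  · rfl

/-- The bound names of a transition can be renamed. Since a process `app P a` can have `a` as a
bound name of a transition if the parameter of `P` does not occur in `P`, the free names that are
among the bound names are allowed to be renamed independently. -/
theorem Step.rename {P P' : PiProc G} {μ : Act G} (h : Step P μ P')
    {π : ∀ u, Name G u → Name G u} (hπ : ∀ u, Function.Injective (π u)) :
    ∀ ρ : ∀ u, Name G u → Name G u, (∀ x ∈ P.fn, x ∉ μ.bn → sig ρ x = sig π x) →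
      (∀ x ∈ μ.bn, sig π x ∉ (P.map ρ).fn) →
      (∀ x ∈ P.fn, x ∈ μ.bn → ∀ y, sig ρ x ≠ sig π y) →
      Step (P.map ρ) (μ.map π) (P'.map π) := by
  have hs : Function.Injective (sig π) := sig_injective hπ
  -- Without a clash between bound and free names, `ρ` agrees with `π` on all free names, and the
  -- claim reduces to `Step.map`.
  have direct : ∀ {P P' : PiProc G} {μ : Act G}, Step P μ P' → Disjoint μ.bn P.fn →
      ∀ ρ : ∀ u, Name G u → Name G u, (∀ x ∈ P.fn, x ∉ μ.bn → sig ρ x = sig π x) →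
      Step (P.map ρ) (μ.map π) (P'.map π) := by
    intro P P' μ h hd ρ h₁
    have : P.map ρ = P.map π := Proc.map_congr _ fun u x hx =>
      eq_of_heq (Sigma.mk.inj (h₁ ⟨u, x⟩ hx fun hb => Set.disjoint_left.1 hd hb hx)).2
    rw [this]
    exact h.map hπ
  induction h with
  | inp a P b hb hfr => exact fun ρ h₁ _ _ => direct (Step.inp a P b hb hfr) hfr ρ h₁
  | rep a P b hb hfr => exact fun ρ h₁ _ _ => direct (Step.rep a P b hb hfr) hfr ρ h₁
  | out a b => exact fun ρ h₁ _ _ => direct (Step.out a b) (Set.empty_disjoint _) ρ h₁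
  | comL d hP hQ hfr hn he =>
    exact fun ρ h₁ _ _ => direct (Step.comL d hP hQ hfr hn he) (Set.empty_disjoint _) ρ h₁
  | comR d hP hQ hfr hn he =>
    exact fun ρ h₁ _ _ => direct (Step.comR d hP hQ hfr hn he) (Set.empty_disjoint _) ρ h₁
  | @parL P P' μ Q hP hfr ih =>
    intro ρ h₁ h₂ h₃
    have hQ : Q.map ρ = Q.map π := Proc.map_congr _ fun u x hx =>
      eq_of_heq (Sigma.mk.inj (h₁ ⟨u, x⟩ (Or.inr hx)
        fun hb => Set.disjoint_left.1 hfr hb hx)).2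
    simp only [Proc.map]
    rw [← hQ]
    refine Step.parL _ (ih ρ (fun x hx => h₁ x (Or.inl hx)) (fun x hx h => h₂ x hx (Or.inl h))
      fun x hx => h₃ x (Or.inl hx)) ?_
    rw [Act.bn_map]
    refine Set.disjoint_left.2 ?_
    rintro _ ⟨x, hx, rfl⟩ h
    exact h₂ x hx (Or.inr h)
  | @parR Q Q' μ P hQ hfr ih =>
    intro ρ h₁ h₂ h₃
    have hP : P.map ρ = P.map π := Proc.map_congr _ fun u x hx =>
      eq_of_heq (Sigma.mk.inj (h₁ ⟨u, x⟩ (Or.inl hx)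
        fun hb => Set.disjoint_left.1 hfr hb hx)).2
    simp only [Proc.map]
    rw [← hP]
    refine Step.parR _ (ih ρ (fun x hx => h₁ x (Or.inr hx)) (fun x hx h => h₂ x hx (Or.inr h))
      fun x hx => h₃ x (Or.inr hx)) ?_
    rw [Act.bn_map]
    refine Set.disjoint_left.2 ?_
    rintro _ ⟨x, hx, rfl⟩ h
    exact h₂ x hx (Or.inl h)
  | @res s P P' μ c hc hP hμ ih =>
    intro ρ h₁ h₂ h₃
    rw [Proc.map_nu hπ]
    have hbn : (⟨s, c⟩ : SName G) ∉ μ.bn := fun h => hμ (Act.bn_subset_names _ h)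
    have hcases : ∀ x ∈ (P.inst (single c)).fn, x ≠ ⟨s, c⟩ → x ∈ (Proc.res P).fn :=
      fun x hx hne => (Proc.fn_inst_single_subset P c hx).resolve_left hne
    -- The name that opens the restriction follows `π`, as the action does, while the other free
    -- names follow `ρ`. The third hypothesis then prevents a clashing free name from being sent to
    -- the new name of the restriction.
    have ih' := ih (updateName ρ c (π s c)) ?_ ?_ ?_
    · rw [Proc.map_inst_updateName hc] at ih'
      refine Step.res _ ?_ ih' ?_
      · change _ ∉ ((Proc.res P).map ρ).fn
        rw [Proc.fn_map]
        rintro ⟨x, hx, e⟩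
        by_cases hb : x ∈ μ.bn
        · exact h₃ x hx hb ⟨s, c⟩ e
        · rw [h₁ x hx hb] at e
          exact hc (hs (a₂ := ⟨s, c⟩) e ▸ hx)
      · rw [Act.names_map]
        exact fun h => hμ (hs.mem_set_image.1 h)
    · intro x hx hb
      by_cases hxc : x = ⟨s, c⟩
      · rw [hxc, sig_updateName_self]; rfl
      · rw [sig_updateName_of_ne _ _ hxc, h₁ x (hcases x hx hxc) hb]
    · rw [Proc.fn_map]
      rintro x hx ⟨y, hy, e⟩
      by_cases hyc : y = ⟨s, c⟩
      · rw [hyc, sig_updateName_self] at e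
        exact hbn (hs (a₁ := ⟨s, c⟩) e ▸ hx)
      · rw [sig_updateName_of_ne _ _ hyc] at e
        refine h₂ x hx ?_
        rw [Proc.fn_map]
        exact ⟨y, hcases y hy hyc, e⟩
    · intro x hx hb y
      have hxc : x ≠ ⟨s, c⟩ := by rintro rfl; exact hbn hb
      rw [sig_updateName_of_ne _ _ hxc]
      exact h₃ x (hcases x hx hxc) hb y
  | @opn s t P P' D a b c hc hP hb hD hne ih =>
    intro ρ h₁ h₂ h₃
    have hcases : ∀ x ∈ (P.inst (single c)).fn, x ≠ ⟨s, c⟩ → x ∈ (Proc.res P).fn :=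
      fun x hx hne => (Proc.fn_inst_single_subset P c hx).resolve_left hne
    have ih' := ih (updateName ρ c (π s c)) ?_ ?_ ?_
    · rw [Proc.map_inst_updateName hc] at ih'
      simp only [Act.map, Set.image_insert_eq]
      refine Step.opn _ ?_ ih' ?_ ?_ ?_
      · exact h₂ _ (Or.inl rfl)
      · obtain ⟨i, hi⟩ := hb
        exact ⟨i, congrArg (sig π) hi⟩
      · exact fun h => hD (hs.mem_set_image.1 h)
      · exact fun h => hne (hs h)
    · intro x hx hb
      by_cases hxc : x = ⟨s, c⟩
      · rw [hxc, sig_updateName_self]; rfl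
      · rw [sig_updateName_of_ne _ _ hxc, h₁ x (hcases x hx hxc)]
        rintro (h | h)
        · exact hxc h
        · exact hb h
    · rw [Proc.fn_map]
      rintro x hx ⟨y, hy, e⟩
      by_cases hyc : y = ⟨s, c⟩
      · rw [hyc, sig_updateName_self] at e
        exact hD (hs (a₁ := ⟨s, c⟩) e ▸ hx)
      · rw [sig_updateName_of_ne _ _ hyc] at e
        refine h₂ x (Or.inr hx) ?_
        rw [Proc.fn_map]
        exact ⟨y, hcases y hy hyc, e⟩
    · intro x hx hb y
      have hxc : x ≠ ⟨s, c⟩ := by rintro rfl; exact hD hb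
      rw [sig_updateName_of_ne _ _ hxc]
      exact h₃ x (hcases x hx hxc) (Or.inr hb) y
  | @app s P P' μ b hP ih =>
    intro ρ h₁ h₂ h₃
    have hsub := Proc.fn_inst_subset_app P b
    refine Step.app _ ?_
    have := ih ρ (fun x hx => h₁ x (hsub hx)) (fun x hx h => h₂ x hx ?_)
      fun x hx => h₃ x (hsub hx)
    · rwa [Proc.map_inst, map_single] at this
    · rw [Proc.fn_map] at h ⊢
      exact Set.image_mono hsub h

/-- A transition with bound names that are moved away from the free names. -/
theorem Step.move {P P' : PiProc G} {μ : Act G} (h : Step P μ P')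
    {π : ∀ u, Name G u → Name G u} (hπ : ∀ u, Function.Injective (π u))
    (h₁ : ∀ x ∈ P.fn, x ∉ μ.bn → sig π x = x) (h₂ : ∀ x ∈ μ.bn, sig π x ∉ P.fn)
    (h₃ : ∀ x, sig π x ∉ μ.bn) : Step P (μ.map π) (P'.map π) := by
  have := h.rename hπ (fun _ x => x) (fun x hx hb => (h₁ x hx hb).symm)
    (by rwa [Proc.map_id]) (fun x _ hb y e => h₃ y (e ▸ hb))
  rwa [Proc.map_id] at this

open Classical in
/-- The substitution that replaces all elements of `B` by names with number `N`. -/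
noncomputable def avoid (B : Set (SName G)) (N : ℕ) : ∀ u, Name G u → Name G u :=
  fun u x => if (⟨u, x⟩ : SName G) ∈ B then N else x

theorem sig_avoid_of_notMem {B : Set (SName G)} (N : ℕ) {x : SName G} (h : x ∉ B) :
    sig (avoid B N) x = x := by
  rw [sig, avoid, if_neg h]

theorem sig_avoid_notMem {B : Set (SName G)} {N : ℕ} (h : ∀ u, (⟨u, N⟩ : SName G) ∉ B)
    (x : SName G) : sig (avoid B N) x ∉ B := by
  by_cases hx : x ∈ B
  · rw [sig, avoid, if_pos hx]
    exact h _
  · rwa [sig_avoid_of_notMem N hx]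

theorem Act.map_eq_self {μ : Act G} {π : ∀ u, Name G u → Name G u}
    (h : ∀ x ∈ μ.names, sig π x = x) : μ.map π = μ := by
  have hx : ∀ {u : G.S} {x : Name G u}, (⟨u, x⟩ : SName G) ∈ μ.names → π u x = x :=
    fun hm => eq_of_sig_eq (h _ hm)
  cases μ with
  | tau => rfl
  | inp a b =>
    simp only [Act.map]
    rw [hx (Or.inl rfl)]
    congr 1
    funext i
    exact hx (Or.inr ⟨i, rfl⟩)
  | out D a b =>
    simp only [Act.map]
    rw [hx (Or.inl (Or.inl rfl))]
    congr 1
    · exact (Set.image_congr fun x hx => h x (Or.inr hx)).trans (Set.image_id D)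
    · funext i
      exact hx (Or.inl (Or.inr ⟨i, rfl⟩))

/-- The free names of a process that are among the bound names of a transition can be replaced by
other ones. -/
theorem Step.exists_avoid {P P' : PiProc G} {μ : Act G} (h : Step P μ P') :
    ∃ N, (∀ u, (⟨u, N⟩ : SName G) ∉ μ.bn) ∧ Step (P.map (avoid μ.bn N)) μ P' := by
  obtain ⟨N, hN⟩ := exists_bound ((h.names_finite.union P.fn_finite).union P'.fn_finite)
  have inj : Function.Injective (fun n : ℕ => if n < N then n else n + 1) := by
    intro m n h
    dsimp only at h
    split_ifs at h <;> omega
  -- `π` fixes every name that occurs in the transition but skips `N`. The clashing free names can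
  -- thus be sent to `N`, which is outside the range of `π`, as `Step.rename` demands.
  let π : ∀ u, Name G u → Name G u := fun u (n : ℕ) => if n < N then n else n + 1
  have hfix : ∀ x : SName G, x.2 < N → sig π x = x := by
    rintro ⟨u, n⟩ hn
    simp only [sig, π]
    rw [if_pos hn]
  have hfix' : ∀ x ∈ μ.names, sig π x = x := fun x hx => hfix x (hN x (Or.inl (Or.inl hx)))
  have hB : ∀ u, (⟨u, N⟩ : SName G) ∉ μ.bn := fun u hu =>
    lt_irrefl _ (hN _ (Or.inl (Or.inl (μ.bn_subset_names hu))))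
  have hP' : P'.map π = P' := Proc.map_eq_self fun u x hx =>
    eq_of_heq (Sigma.mk.inj (hfix ⟨u, x⟩ (hN _ (Or.inr hx)))).2
  have hμ : μ.map π = μ := Act.map_eq_self hfix'
  refine ⟨N, hB, ?_⟩
  have := h.rename (π := π) (fun _ => inj) (avoid μ.bn N) ?_ ?_ ?_
  · rwa [hμ, hP'] at this
  · intro x hx hb
    rw [sig_avoid_of_notMem _ hb, hfix x (hN _ (Or.inl (Or.inr hx)))]
  · intro x hx h
    rw [hfix' x (μ.bn_subset_names hx), Proc.fn_map] at h
    obtain ⟨y, _, rfl⟩ := h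
    exact sig_avoid_notMem hB y hx
  · rintro ⟨u, x⟩ hx hb ⟨v, y⟩ e
    simp only [sig, avoid, if_pos hb] at e
    obtain rfl : u = v := congrArg Sigma.fst e
    have hne : ∀ y : ℕ, N ≠ if y < N then y else y + 1 := by
      intro y e
      split_ifs at e <;> omega
    exact hne y (eq_of_heq (Sigma.mk.inj e).2)

/-! # Conversion of bound names -/

/-- This is `α`-conversion: among the free names only those about to be bound are moved,
injectively, so the closed body does not change. The next lemmas are the instances for restriction
and tuple substitution. -/
theorem Proc.map_bind_eq {B : G.S → Type} {P : PiProc G} {β : ∀ u, B u → Name G u}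
    {π : ∀ u, Name G u → Name G u} (hπ : ∀ u, Function.Injective (π u))
    (h : ∀ x ∈ P.fn, (∀ i, β x.1 i ≠ x.2) → sig π x = x) :
    (P.map π).bind (fun u i => π u (β u i)) = P.bind β := by
  rw [← Proc.map_bind P β hπ]
  apply Proc.map_eq_self
  rintro u (x | x) hx
  · have hx' := (Proc.fn_bind P β (x := ⟨u, x⟩)).1 hx
    have := eq_of_heq (Sigma.mk.inj (h _ hx'.1 hx'.2)).2
    exact congrArg Sum.inl this
  · rfl

theorem Proc.nu_map_eq {P : PiProc G} {s : G.S} (c : Name G s) {π : ∀ u, Name G u → Name G u}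
    (hπ : ∀ u, Function.Injective (π u)) (h : ∀ x ∈ P.fn, x ≠ ⟨s, c⟩ → sig π x = x) :
    Proc.nu (π s c) (P.map π) = Proc.nu c P := by
  unfold Proc.nu
  rw [← map_single c π, Proc.map_bind_eq hπ]
  intro x hx hne
  refine h x hx ?_
  rintro rfl
  exact hne ⟨rfl⟩ rfl

theorem Proc.substTuple_map_eq {P : PiProc G} {s : G.S} (b c : ∀ i, Name G (G.ob s i))
    {π : ∀ u, Name G u → Name G u} (hπ : ∀ u, Function.Injective (π u))
    (h : ∀ x ∈ P.fn, x ∉ Set.range (fun i => (⟨_, c i⟩ : SName G)) → sig π x = x) :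
    (P.map π).substTuple b (fun i => π _ (c i)) = P.substTuple b c := by
  unfold Proc.substTuple
  rw [← map_tuple c π, Proc.map_bind_eq hπ]
  intro x hx hne
  refine h x hx ?_
  rintro ⟨i, rfl⟩
  exact hne ⟨i, rfl⟩ rfl

theorem Proc.mem_fn_nus {d : List (SName G)} {P : PiProc G} {x : SName G}
    (h : x ∈ (Proc.nus d P).fn) : x ∈ P.fn ∧ x ∉ d := by
  induction d with
  | nil => exact ⟨h, by simp⟩
  | cons c d ih =>
    have h' := (Proc.fn_bind (Proc.nus d P) (single c.2) (x := x)).1 h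
    refine ⟨(ih h'.1).1, ?_⟩
    rintro hx
    rcases List.mem_cons.1 hx with rfl | hx
    · exact h'.2 ⟨rfl⟩ rfl
    · exact (ih h'.1).2 hx

theorem Proc.nus_map_eq {d : List (SName G)} {P : PiProc G} {π : ∀ u, Name G u → Name G u}
    (hπ : ∀ u, Function.Injective (π u)) (h : ∀ x ∈ P.fn, x ∉ d → sig π x = x) :
    Proc.nus (d.map (sig π)) (P.map π) = Proc.nus d P := by
  rw [← Proc.map_nus hπ]
  apply Proc.map_eq_self
  intro u x hx
  have hx' := Proc.mem_fn_nus hx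
  exact eq_of_heq (Sigma.mk.inj (h _ hx'.1 hx'.2)).2

/-! # Processes that are obtained from a common context -/

/-- `P` and `Q` are obtained by filling the holes of a common context with substitution instances of
pairs of processes from `Base`. -/
inductive CtxRel {Z : G.S → Type} (Base : Proc Z → Proc Z → Prop) :
    {X : G.S → Type} → Proc X → Proc X → Prop
  | hole {X : G.S → Type} {A B : Proc Z} (h : Base A B) (σ : ∀ u, Z u → X u) :
      CtxRel Base (A.map σ) (B.map σ)
  | nil {X : G.S → Type} : CtxRel Base (Proc.nil : Proc X) Proc.nil
  | inp {X : G.S → Type} {s : G.S} (a : X s) {P Q : Proc (Ext X (Par s))} (h : CtxRel Base P Q) :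
      CtxRel Base (Proc.inp a P) (Proc.inp a Q)
  | out {X : G.S → Type} {s : G.S} (a : X s) (b : ∀ i, X (G.ob s i)) :
      CtxRel Base (Proc.out a b) (Proc.out a b)
  | par {X : G.S → Type} {P P' Q Q' : Proc X} (h : CtxRel Base P Q) (h' : CtxRel Base P' Q') :
      CtxRel Base (Proc.par P P') (Proc.par Q Q')
  | res {X : G.S → Type} {s : G.S} {P Q : Proc (Ext X (One s))} (h : CtxRel Base P Q) :
      CtxRel Base (Proc.res P) (Proc.res Q)
  | rep {X : G.S → Type} {s : G.S} (a : X s) {P Q : Proc (Ext X (Par s))} (h : CtxRel Base P Q) :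
      CtxRel Base (Proc.rep a P) (Proc.rep a Q)
  | app {X : G.S → Type} {s : G.S} {P Q : Proc (Ext X (One s))} (h : CtxRel Base P Q) (a : X s) :
      CtxRel Base (Proc.app P a) (Proc.app Q a)

/-- As `CtxRel`, for a context where all holes are underneath prefixes. -/
inductive GuardedRel {Z : G.S → Type} (Base : Proc Z → Proc Z → Prop) :
    {X : G.S → Type} → Proc X → Proc X → Prop
  | nil {X : G.S → Type} : GuardedRel Base (Proc.nil : Proc X) Proc.nil
  | inp {X : G.S → Type} {s : G.S} (a : X s) {P Q : Proc (Ext X (Par s))} (h : CtxRel Base P Q) :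
      GuardedRel Base (Proc.inp a P) (Proc.inp a Q)
  | out {X : G.S → Type} {s : G.S} (a : X s) (b : ∀ i, X (G.ob s i)) :
      GuardedRel Base (Proc.out a b) (Proc.out a b)
  | par {X : G.S → Type} {P P' Q Q' : Proc X} (h : GuardedRel Base P Q)
      (h' : GuardedRel Base P' Q') : GuardedRel Base (Proc.par P P') (Proc.par Q Q')
  | res {X : G.S → Type} {s : G.S} {P Q : Proc (Ext X (One s))} (h : GuardedRel Base P Q) :
      GuardedRel Base (Proc.res P) (Proc.res Q)
  | rep {X : G.S → Type} {s : G.S} (a : X s) {P Q : Proc (Ext X (Par s))} (h : CtxRel Base P Q) :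
      GuardedRel Base (Proc.rep a P) (Proc.rep a Q)
  | app {X : G.S → Type} {s : G.S} {P Q : Proc (Ext X (One s))} (h : GuardedRel Base P Q)
      (a : X s) : GuardedRel Base (Proc.app P a) (Proc.app Q a)

section

variable {Z : G.S → Type} {Base : Proc Z → Proc Z → Prop}

theorem CtxRel.refl {X : G.S → Type} (P : Proc X) : CtxRel Base P P := by
  induction P with
  | nil => exact .nil
  | inp a P ih => exact .inp a ih
  | out a b => exact .out a b
  | par P Q ihP ihQ => exact .par ihP ihQ
  | res P ih => exact .res ih
  | rep a P ih => exact .rep a ih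
  | app P a ih => exact .app ih a

theorem GuardedRel.refl {X : G.S → Type} (P : Proc X) : GuardedRel Base P P := by
  induction P with
  | nil => exact .nil
  | inp a P ih => exact .inp a (.refl P)
  | out a b => exact .out a b
  | par P Q ihP ihQ => exact .par ihP ihQ
  | res P ih => exact .res ih
  | rep a P ih => exact .rep a (.refl P)
  | app P a ih => exact .app ih a

/-- Substitutions are absorbed by those carried at the holes; hence derivatives, which arise by
instantiating and rebinding names, stay within a common context. -/
theorem CtxRel.map {X : G.S → Type} {P Q : Proc X} (h : CtxRel Base P Q) :
    ∀ {Y : G.S → Type} (f : ∀ u, X u → Y u), CtxRel Base (P.map f) (Q.map f) := by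
  induction h with
  | hole h σ =>
    intro Y f
    rw [Proc.map_map, Proc.map_map]
    exact .hole h _
  | nil => exact fun _ => .nil
  | inp a _ ih => exact fun f => .inp _ (ih _)
  | out a b => exact fun f => .out _ _
  | par _ _ ih ih' => exact fun f => .par (ih _) (ih' _)
  | res _ ih => exact fun f => .res (ih _)
  | rep a _ ih => exact fun f => .rep _ (ih _)
  | app _ a ih => exact fun f => .app (ih _) _

theorem GuardedRel.map {X : G.S → Type} {P Q : Proc X} (h : GuardedRel Base P Q) :
    ∀ {Y : G.S → Type} (f : ∀ u, X u → Y u), GuardedRel Base (P.map f) (Q.map f) := by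
  induction h with
  | nil => exact fun _ => .nil
  | inp a h => exact fun f => .inp _ (h.map _)
  | out a b => exact fun f => .out _ _
  | par _ _ ih ih' => exact fun f => .par (ih _) (ih' _)
  | res _ ih => exact fun f => .res (ih _)
  | rep a h => exact fun f => .rep _ (h.map _)
  | app _ a ih => exact fun f => .app (ih _) _

theorem GuardedRel.ctxRel {X : G.S → Type} {P Q : Proc X} (h : GuardedRel Base P Q) :
    CtxRel Base P Q := by
  induction h with
  | nil => exact .nil
  | inp a h => exact .inp a h
  | out a b => exact .out a b
  | par _ _ ih ih' => exact .par ih ih'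
  | res _ ih => exact .res ih
  | rep a h => exact .rep a h
  | app _ a ih => exact .app ih a

theorem CtxRel.nus {P Q : PiProc G} (h : CtxRel Base P Q) (d : List (SName G)) :
    CtxRel Base (Proc.nus d P) (Proc.nus d Q) := by
  induction d with
  | nil => exact h
  | cons c d ih => exact .res (ih.map _)

theorem CtxRel.substTuple {P Q : PiProc G} (h : CtxRel Base P Q) {s : G.S}
    (b c : ∀ i, Name G (G.ob s i)) : CtxRel Base (P.substTuple b c) (Q.substTuple b c) :=
  (h.map _).map _

end

/-- `CtxRel` on agents. -/
def AgentCtxRel {Z : G.S → Type} (Base : Proc Z → Proc Z → Prop) :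
    (k : Kind G) → Agent k → Agent k → Prop
  | Kind.proc, A, B => CtxRel Base (X := Name G) A B
  | Kind.abs s, A, B => CtxRel Base (X := Ext (Name G) (One s)) A B

/-- `GuardedRel` on agents. -/
def AgentGuardedRel {Z : G.S → Type} (Base : Proc Z → Proc Z → Prop) :
    (k : Kind G) → Agent k → Agent k → Prop
  | Kind.proc, A, B => GuardedRel Base (X := Name G) A B
  | Kind.abs s, A, B => GuardedRel Base (X := Ext (Name G) (One s)) A B

section

variable {Z : G.S → Type} {Base : Proc Z → Proc Z → Prop} {ι : Type} {κ : ι → Kind G}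
  {A B : ∀ i, Agent (κ i)}

theorem AgentGuardedRel.refl {k : Kind G} (A : Agent k) : AgentGuardedRel Base k A A := by
  cases k <;> exact GuardedRel.refl _

theorem AgentGuardedRel.ctxRel {k : Kind G} {A B : Agent k} (h : AgentGuardedRel Base k A B) :
    AgentCtxRel Base k A B := by
  cases k <;> exact GuardedRel.ctxRel h

theorem AgentCtxRel.fill {k : Kind G} (C : Ctx κ k) (h : ∀ i, AgentCtxRel Base _ (A i) (B i)) :
    AgentCtxRel Base k (C.fill A) (C.fill B) := by
  induction C with
  | hole i => exact h i
  | agent D => exact (AgentGuardedRel.refl D).ctxRel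
  | inp a b hb C ih => exact CtxRel.inp a (CtxRel.map ih _)
  | rep a b hb C ih => exact CtxRel.rep a (CtxRel.map ih _)
  | par C D ihC ihD => exact CtxRel.par ihC ihD
  | res c C ih => exact CtxRel.res (CtxRel.map ih _)
  | app C a ih => exact CtxRel.app ih a
  | abs c C ih => exact CtxRel.map ih _

/-- What is put in the holes is already guarded, so the context need not be. This is the form used
for abstraction contexts. -/
theorem AgentGuardedRel.fill {k : Kind G} (C : Ctx κ k)
    (h : ∀ i, AgentGuardedRel Base _ (A i) (B i)) :
    AgentGuardedRel Base k (C.fill A) (C.fill B) := by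
  have h' : ∀ i, AgentCtxRel Base _ (A i) (B i) := fun i => (h i).ctxRel
  induction C with
  | hole i => exact h i
  | agent D => exact .refl D
  | inp a b hb C ih => exact GuardedRel.inp a (CtxRel.map (AgentCtxRel.fill C h') _)
  | rep a b hb C ih => exact GuardedRel.rep a (CtxRel.map (AgentCtxRel.fill C h') _)
  | par C D ihC ihD => exact GuardedRel.par ihC ihD
  | res c C ih => exact GuardedRel.res (GuardedRel.map ih _)
  | app C a ih => exact GuardedRel.app ih a
  | abs c C ih => exact GuardedRel.map ih _

/-- Here the prefixes above the holes come from the context itself; this is the form used for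
variable contexts. -/
theorem AgentGuardedRel.fill_of_guarded {k : Kind G} (C : Ctx κ k) (hC : C.Guarded)
    (h : ∀ i, AgentCtxRel Base _ (A i) (B i)) :
    AgentGuardedRel Base k (C.fill A) (C.fill B) := by
  induction C with
  | hole i => exact hC.elim
  | agent D => exact .refl D
  | inp a b hb C ih => exact GuardedRel.inp a (CtxRel.map (AgentCtxRel.fill C h) _)
  | rep a b hb C ih => exact GuardedRel.rep a (CtxRel.map (AgentCtxRel.fill C h) _)
  | par C D ihC ihD => exact GuardedRel.par (ihC hC.1) (ihD hC.2)
  | res c C ih => exact GuardedRel.res (GuardedRel.map (ih hC) _)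
  | app C a ih => exact GuardedRel.app (ih hC) a
  | abs c C ih => exact GuardedRel.map (ih hC) _

end

/-! ## Back to contexts -/

theorem Ctx.fill_comp {ι ι' : Type} {κ : ι → Kind G} {κ' : ι' → Kind G} {k : Kind G}
    (C : Ctx κ k) (D : ∀ i, Ctx κ' (κ i)) (A : ∀ i, Agent (κ' i)) :
    (C.comp D).fill A = C.fill (fun i => (D i).fill A) := by
  induction C with
  | hole i => rfl
  | agent => rfl
  | inp a b hb C ih => exact congrArg (fun P : PiProc G => Proc.inp a (P.bind (tuple b))) ih
  | rep a b hb C ih => exact congrArg (fun P : PiProc G => Proc.rep a (P.bind (tuple b))) ih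
  | par C D ihC ihD => exact congrArg₂ Proc.par ihC ihD
  | res c C ih => exact congrArg (fun P : PiProc G => Proc.res (P.bind (single c))) ih
  | @app s C a ih =>
    exact congrArg (fun P : Proc (Ext (Name G) (One s)) => Proc.app P a) ih
  | abs c C ih => exact congrArg (fun P : PiProc G => P.bind (single c)) ih

theorem bind_inst_tuple {X : G.S → Type} {s : G.S} {P : Proc (Ext X (Par s))}
    (ρ : ∀ u, X u → Name G u) {b : ∀ i, Name G (G.ob s i)} (hb : Distinct b)
    (h : ∀ i, (⟨_, b i⟩ : SName G) ∉
      {x | (⟨x.1, Sum.inl x.2⟩ : Σ u, Ext (Name G) (Par s) u) ∈ (P.map (liftMap ρ)).fn}) :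
    (P.map (fun u => Sum.elim (ρ u) (tuple (X := Name G) b u))).bind (tuple b) =
      P.map (liftMap ρ) := by
  rw [← Proc.inst_map_liftMap P ρ (tuple b)]
  refine Proc.bind_inst hb.tuple_injective fun u i hi => ?_
  have e := sigma_tuple (X := Name G) b u i
  exact h i.1 (e ▸ hi : _)

theorem bind_inst_single {X : G.S → Type} {s : G.S} {P : Proc (Ext X (One s))}
    (ρ : ∀ u, X u → Name G u) {c : Name G s}
    (h : (⟨s, c⟩ : SName G) ∉
      {x | (⟨x.1, Sum.inl x.2⟩ : Σ u, Ext (Name G) (One s) u) ∈ (P.map (liftMap ρ)).fn}) :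
    (P.map (fun u => Sum.elim (ρ u) (single (X := Name G) c u))).bind (single c) =
      P.map (liftMap ρ) := by
  rw [← Proc.inst_map_liftMap P ρ (single c)]
  refine Proc.bind_inst (single_injective c) fun u i hi => ?_
  have e := sigma_single (X := Name G) c u i
  exact h (e ▸ hi : _)

theorem finite_free {X B : G.S → Type} (P : Proc (Ext X B)) :
    {x : Σ u, X u | (⟨x.1, Sum.inl x.2⟩ : Σ u, Ext X B u) ∈ P.fn}.Finite :=
  P.fn_finite.preimage
    (sig_injective (f := fun _ x => Sum.inl x) fun _ => Sum.inl_injective).injOn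

/-- Processes that are obtained from a common context are instances of a polyadic context. -/
theorem CtxRel.exists_ctx {Z : G.S → Type} {Base : Proc Z → Proc Z → Prop} {X : G.S → Type}
    {P Q : Proc X} (h : CtxRel Base P Q) : ∀ ρ : ∀ u, X u → Name G u,
    ∃ (n : ℕ) (C : Ctx (fun _ : Fin n => Kind.proc (G := G)) Kind.proc) (Ps Qs : Fin n → PiProc G),
      C.fill Ps = P.map ρ ∧ C.fill Qs = Q.map ρ ∧
      ∀ i, ∃ A B σ, Base A B ∧ Ps i = A.map σ ∧ Qs i = B.map σ := by
  induction h with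
  | @hole X A B h σ =>
    intro ρ
    exact ⟨1, Ctx.hole (κ := fun _ : Fin 1 => Kind.proc) 0, fun _ => (A.map σ).map ρ,
      fun _ => (B.map σ).map ρ, rfl, rfl, fun _ => ⟨A, B, _, h, Proc.map_map _ _ _,
      Proc.map_map _ _ _⟩⟩
  | nil => exact fun ρ => ⟨0, Ctx.agent (k := Kind.proc) Proc.nil, fun _ => .nil, fun _ => .nil,
      rfl, rfl, fun i => i.elim0⟩
  | out a b => exact fun ρ => ⟨0, Ctx.agent (k := Kind.proc) (Proc.map ρ (Proc.out a b)),
      fun _ => .nil, fun _ => .nil, rfl, rfl, fun i => i.elim0⟩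
  | @inp X s a P Q _ ih =>
    intro ρ
    -- One choice of parameters must be fresh for both bodies, since the same named context has to
    -- produce both processes.
    obtain ⟨b, hb, hfr⟩ := exists_fresh_tuple
      ((finite_free (P.map (liftMap ρ))).union (finite_free (Q.map (liftMap ρ)))) s
    obtain ⟨n, C, Ps, Qs, hP, hQ, hi⟩ := ih fun u => Sum.elim (ρ u) (tuple b u)
    refine ⟨n, Ctx.inp (ρ _ a) b hb C, Ps, Qs, ?_, ?_, hi⟩
    · simp only [Ctx.fill, Proc.map]
      rw [hP, bind_inst_tuple ρ hb fun i h => hfr i (Or.inl h)]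
    · simp only [Ctx.fill, Proc.map]
      rw [hQ, bind_inst_tuple ρ hb fun i h => hfr i (Or.inr h)]
  | @rep X s a P Q _ ih =>
    intro ρ
    obtain ⟨b, hb, hfr⟩ := exists_fresh_tuple
      ((finite_free (P.map (liftMap ρ))).union (finite_free (Q.map (liftMap ρ)))) s
    obtain ⟨n, C, Ps, Qs, hP, hQ, hi⟩ := ih fun u => Sum.elim (ρ u) (tuple b u)
    refine ⟨n, Ctx.rep (ρ _ a) b hb C, Ps, Qs, ?_, ?_, hi⟩
    · simp only [Ctx.fill, Proc.map]
      rw [hP, bind_inst_tuple ρ hb fun i h => hfr i (Or.inl h)]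
    · simp only [Ctx.fill, Proc.map]
      rw [hQ, bind_inst_tuple ρ hb fun i h => hfr i (Or.inr h)]
  | @res X s P Q _ ih =>
    intro ρ
    obtain ⟨c, hc⟩ := exists_fresh
      ((finite_free (P.map (liftMap ρ))).union (finite_free (Q.map (liftMap ρ)))) s
    obtain ⟨n, C, Ps, Qs, hP, hQ, hi⟩ := ih fun u => Sum.elim (ρ u) (single c u)
    refine ⟨n, Ctx.res c C, Ps, Qs, ?_, ?_, hi⟩
    · simp only [Ctx.fill, Proc.map]
      rw [hP, bind_inst_single ρ fun h => hc (Or.inl h)]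
    · simp only [Ctx.fill, Proc.map]
      rw [hQ, bind_inst_single ρ fun h => hc (Or.inr h)]
  | @app X s P Q _ a ih =>
    intro ρ
    obtain ⟨c, hc⟩ := exists_fresh
      ((finite_free (P.map (liftMap ρ))).union (finite_free (Q.map (liftMap ρ)))) s
    obtain ⟨n, C, Ps, Qs, hP, hQ, hi⟩ := ih fun u => Sum.elim (ρ u) (single c u)
    refine ⟨n, Ctx.app (Ctx.abs c C) (ρ _ a), Ps, Qs, ?_, ?_, hi⟩
    · simp only [Ctx.fill, Proc.map]
      rw [hP, bind_inst_single ρ fun h => hc (Or.inl h)]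
    · simp only [Ctx.fill, Proc.map]
      rw [hQ, bind_inst_single ρ fun h => hc (Or.inr h)]
  | par _ _ ih₁ ih₂ =>
    intro ρ
    obtain ⟨n, C, Ps, Qs, hP, hQ, hi⟩ := ih₁ ρ
    obtain ⟨m, D, Ps', Qs', hP', hQ', hi'⟩ := ih₂ ρ
    -- The holes of the two subcontexts are numbered consecutively, by reindexing them into `Fin (n
    -- + m)`.
    refine ⟨n + m, Ctx.par
      (C.comp fun i => Ctx.hole (κ := fun _ : Fin (n + m) => Kind.proc) (Fin.castAdd m i))
      (D.comp fun i => Ctx.hole (κ := fun _ : Fin (n + m) => Kind.proc) (Fin.natAdd n i)),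
      Fin.append Ps Ps', Fin.append Qs Qs', ?_, ?_, ?_⟩
    · refine congrArg₂ Proc.par ?_ ?_
      · refine (Ctx.fill_comp _ _ _).trans (Eq.trans (congrArg (fun A => C.fill A) ?_) hP)
        exact funext fun i => Fin.append_left _ _ i
      · refine (Ctx.fill_comp _ _ _).trans (Eq.trans (congrArg (fun A => D.fill A) ?_) hP')
        exact funext fun i => Fin.append_right _ _ i
    · refine congrArg₂ Proc.par ?_ ?_
      · refine (Ctx.fill_comp _ _ _).trans (Eq.trans (congrArg (fun A => C.fill A) ?_) hQ)
        exact funext fun i => Fin.append_left _ _ i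
      · refine (Ctx.fill_comp _ _ _).trans (Eq.trans (congrArg (fun A => D.fill A) ?_) hQ')
        exact funext fun i => Fin.append_right _ _ i
    · intro i
      refine Fin.addCases (fun i => ?_) (fun i => ?_) i
      · simpa only [Fin.append_left] using hi i
      · simpa only [Fin.append_right] using hi' i

/-! # Transitions of processes that are obtained from a common guarded context -/

/-- Every transition of `P` is matched by `Q`, with derivatives that are obtained from a common
context. -/
def Matches {Z : G.S → Type} (Base : Proc Z → Proc Z → Prop) (P Q : PiProc G) : Prop :=
  ∀ μ P', Step P μ P' → Disjoint μ.bn Q.fn → ∃ Q', Step Q μ Q' ∧ CtxRel Base P' Q'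

section

variable {Z : G.S → Type} {Base : Proc Z → Proc Z → Prop}

/-- Communications are matched, after a renaming of the bound names of the two transitions. -/
theorem Matches.com {P₁ P₂ Q₁ Q₂ P₁' P₂' : PiProc G} (h₁ : Matches Base P₁ Q₁)
    (h₂ : Matches Base P₂ Q₂) {s : G.S} {a : Name G s} {b c : ∀ i, Name G (G.ob s i)}
    {D : Set (SName G)} (d : List (SName G)) (hP₁ : Step P₁ (Act.inp a c) P₁')
    (hP₂ : Step P₂ (Act.out D a b) P₂') (hfr : Disjoint D P₁.fn) (hn : d.Nodup)
    (hd : {x | x ∈ d} = D) :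
    ∃ (b' c' : ∀ i, Name G (G.ob s i)) (d' : List (SName G)) (P₁'' P₂'' Q₁' Q₂' : PiProc G),
      Step Q₁ (Act.inp a c') Q₁' ∧ Step Q₂ (Act.out {x | x ∈ d'} a b') Q₂' ∧
      Disjoint {x | x ∈ d'} Q₁.fn ∧ d'.Nodup ∧ CtxRel Base P₁'' Q₁' ∧ CtxRel Base P₂'' Q₂' ∧
      Proc.nus d (Proc.par (P₁'.substTuple b c) P₂') =
        Proc.nus d' (Proc.par (P₁''.substTuple b' c') P₂'') ∧
      Proc.nus d (Proc.par P₂' (P₁'.substTuple b c)) =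
        Proc.nus d' (Proc.par P₂'' (P₁''.substTuple b' c')) := by
  -- the parameters of the input are moved away
  obtain ⟨c', P₁'', hP₁', hcQ, hS⟩ : ∃ (c' : ∀ i, Name G (G.ob s i)) (P₁'' : PiProc G),
      Step P₁ (Act.inp a c') P₁'' ∧ (∀ i, (⟨_, c' i⟩ : SName G) ∉ Q₁.fn) ∧
      P₁''.substTuple b c' = P₁'.substTuple b c := by
    have fc : (Act.inp a c).bn.Finite := Set.finite_range _
    obtain ⟨π, hπ, hπ₁, hπ₂, hπ₃⟩ := exists_move fc
      (((P₁.fn_finite.union P₁'.fn_finite).union Q₁.fn_finite).insert ⟨s, a⟩)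
    have ha : π s a = a := eq_of_sig_eq (hπ₃ ⟨s, a⟩ (Or.inl rfl) hP₁.subjectFree)
    have hP₁π := hP₁.move hπ (fun x hx => hπ₃ x (Or.inr (Or.inl (Or.inl hx))))
      (fun x hx h => hπ₁ x hx (Or.inr (Or.inl (Or.inl h)))) hπ₂
    simp only [Act.map, ha] at hP₁π
    exact ⟨_, _, hP₁π, fun i h => hπ₁ _ ⟨i, rfl⟩ (Or.inr (Or.inr h)),
      Proc.substTuple_map_eq b c hπ fun x hx => hπ₃ x (Or.inr (Or.inl (Or.inr hx)))⟩
  rw [← hS]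
  clear hP₁ hS
  -- the extruded names are moved away
  have fD : D.Finite := hd ▸ d.finite_toSet
  have fc : (Set.range (fun i => (⟨_, c' i⟩ : SName G))).Finite := Set.finite_range _
  obtain ⟨π, hπ, hπ₁, hπ₂, hπ₃⟩ := exists_move fD
    ((P₁.fn_finite.union (P₂.fn_finite.union (Q₁.fn_finite.union (Q₂.fn_finite.union
      ((P₁''.substTuple b c').fn_finite.union (P₂'.fn_finite.union fc)))))).insert ⟨s, a⟩)
  simp only [Set.mem_insert_iff, Set.mem_union, not_or] at hπ₁ hπ₃
  have ha : π s a = a := eq_of_sig_eq (hπ₃ _ (Or.inl rfl) hP₂.subjectFree)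
  -- The extruded names are fresh for `P₁`, so `π` leaves `P₁` unchanged and the whole input
  -- transition can be renamed along with the output.
  have hP₁π := hP₁'.map hπ
  have hP₁e : P₁.map π = P₁ := Proc.map_eq_self fun u x hx => eq_of_sig_eq
    (hπ₃ ⟨u, x⟩ (Or.inr (Or.inl hx)) fun hD => Set.disjoint_left.1 hfr hD hx)
  simp only [Act.map, ha, hP₁e] at hP₁π
  have hP₂π := hP₂.move hπ (fun x hx => hπ₃ x (Or.inr (Or.inr (Or.inl hx))))
    (fun x hx h => (hπ₁ x hx).2.2.1 h) hπ₂
  simp only [Act.map, ha] at hP₂π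
  have hd' : {x | x ∈ d.map (sig π)} = sig π '' D := by
    subst hd
    ext x
    simp
  obtain ⟨Q₁', hQ₁, hr₁⟩ := h₁ _ _ hP₁π (by
    refine Set.disjoint_left.2 ?_
    rintro _ ⟨i, rfl⟩ h
    by_cases hi : (⟨_, c' i⟩ : SName G) ∈ D
    · exact (hπ₁ _ hi).2.2.2.1 h
    · have e := hπ₃ ⟨_, c' i⟩ (by simp only [Set.mem_range_self, or_true]) hi
      exact hcQ i (e.subst (motive := (· ∈ Q₁.fn)) h))
  obtain ⟨Q₂', hQ₂, hr₂⟩ := h₂ _ _ hP₂π (by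
    refine Set.disjoint_left.2 ?_
    rintro _ ⟨x, hx, rfl⟩ h
    exact (hπ₁ x hx).2.2.2.2.1 h)
  have hX : ∀ X : PiProc G, X.fn ⊆ (P₁''.substTuple b c').fn ∪ P₂'.fn →
      Proc.nus d X = Proc.nus (d.map (sig π)) (X.map π) := by
    intro X hX
    refine (Proc.nus_map_eq hπ fun x hx hxd => hπ₃ x ?_ ?_).symm
    · rcases hX hx with h | h <;> simp [h]
    · rw [← hd]
      exact hxd
  refine ⟨fun i => π _ (b i), _, d.map (sig π), _, _, Q₁', Q₂', hQ₁, ?_, ?_, hn.map (sig_injective hπ), hr₁, hr₂,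
    ?_, ?_⟩
  · rw [hd']
    exact hQ₂
  · rw [hd']
    refine Set.disjoint_left.2 ?_
    rintro _ ⟨x, hx, rfl⟩ h
    exact (hπ₁ x hx).2.2.2.1 h
  · rw [hX _ subset_rfl]
    simp only [Proc.map]
    rw [Proc.map_substTuple hπ]
  · rw [hX (Proc.par P₂' (P₁''.substTuple b c')) (by simp [Proc.fn, Set.union_comm])]
    simp only [Proc.map]
    rw [Proc.map_substTuple hπ]

theorem Matches.par {P₁ P₂ Q₁ Q₂ : PiProc G} (h₁ : Matches Base P₁ Q₁) (h₂ : Matches Base P₂ Q₂)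
    (r₁ : CtxRel Base P₁ Q₁) (r₂ : CtxRel Base P₂ Q₂) :
    Matches Base (Proc.par P₁ P₂) (Proc.par Q₁ Q₂) := by
  intro μ P' h hfr
  cases h with
  | parL _ h hμ =>
    obtain ⟨Q', hQ, hr⟩ := h₁ _ _ h (hfr.mono_right Set.subset_union_left)
    exact ⟨_, Step.parL _ hQ (hfr.mono_right Set.subset_union_right), .par hr r₂⟩
  | parR _ h hμ =>
    obtain ⟨Q', hQ, hr⟩ := h₂ _ _ h (hfr.mono_right Set.subset_union_right)
    exact ⟨_, Step.parR _ hQ (hfr.mono_right Set.subset_union_left), .par r₁ hr⟩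
  | comL d hP₁ hP₂ hD hn hd =>
    obtain ⟨b', c', d', P₁'', P₂'', Q₁', Q₂', hQ₁, hQ₂, hD', hn', hr₁, hr₂, e, -⟩ :=
      h₁.com h₂ d hP₁ hP₂ hD hn hd
    rw [e]
    exact ⟨_, Step.comL d' hQ₁ hQ₂ hD' hn' rfl, .nus (.par (hr₁.substTuple _ _) hr₂) _⟩
  | comR d hP₁ hP₂ hD hn hd =>
    obtain ⟨b', c', d', P₁'', P₂'', Q₁', Q₂', hQ₁, hQ₂, hD', hn', hr₁, hr₂, -, e⟩ :=
      h₂.com h₁ d hP₂ hP₁ hD hn hd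
    rw [e]
    exact ⟨_, Step.comR d' hQ₂ hQ₁ hD' hn' rfl, .nus (.par hr₂ (hr₁.substTuple _ _)) _⟩

theorem Matches.res {s : G.S} {P Q : Proc (Ext (Name G) (One s))}
    (h : ∀ c : Name G s, Matches Base (P.inst (single c)) (Q.inst (single c))) :
    Matches Base (Proc.res P) (Proc.res Q) := by
  intro μ P' hP hfr
  have hsub : ∀ (c : Name G s) {D : Set (SName G)}, (⟨s, c⟩ : SName G) ∉ D →
      Disjoint D (Proc.res Q).fn → Disjoint D (Q.inst (single c)).fn := by
    intro c D hc hD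
    refine Set.disjoint_left.2 fun x hx hxQ => ?_
    rcases Proc.fn_inst_single_subset Q c hxQ with rfl | h
    · exact hc hx
    · exact Set.disjoint_left.1 hD hx h
  cases hP with
  | @res _ _ P' μ c hc hP hμ =>
    -- The name `c` is fresh for the left process but may be free in the right one, so it is first
    -- exchanged for a name fresh for both. For an extrusion this is unnecessary: there `c` is a
    -- bound name of the action, hence fresh for the right process by assumption.
    obtain ⟨π, hπ, hπ₁, -, hπ₃⟩ := exists_move (Set.finite_singleton (⟨s, c⟩ : SName G))
      ((Proc.res P).fn_finite.union ((Proc.res Q).fn_finite.union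
        (hP.names_finite.union P'.fn_finite)))
    simp only [Set.mem_singleton_iff, Set.mem_union, forall_eq, not_or] at hπ₁ hπ₃
    have hP' := hP.map hπ
    have e₁ : (P.inst (single c)).map π = P.inst (single (π s c)) := by
      rw [Proc.map_inst, map_single]
      congr 1
      apply Proc.map_eq_self
      rintro u (x | x) hx
      · have : sig π ⟨u, x⟩ = ⟨u, x⟩ := hπ₃ _ (Or.inl hx) fun e => hc (e ▸ hx)
        exact congrArg Sum.inl (eq_of_sig_eq this)
      · rfl
    have hn : ∀ x ∈ μ.names, sig π x = x := fun x hx =>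
      hπ₃ x (Or.inr (Or.inr (Or.inl hx))) fun e => hμ (e ▸ hx)
    rw [e₁, Act.map_eq_self hn] at hP'
    have hcμ : (⟨s, π s c⟩ : SName G) ∉ μ.names := hπ₁.2.2.1
    obtain ⟨Q', hQ', hr⟩ := h _ _ _ hP'
      (hsub _ (fun h => hcμ (μ.bn_subset_names h)) hfr)
    refine ⟨_, Step.res (π s c) hπ₁.2.1 hQ' hcμ, ?_⟩
    rw [← Proc.nu_map_eq c hπ fun x hx hne => hπ₃ x (Or.inr (Or.inr (Or.inr hx))) hne]
    exact .res (hr.map _)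
  | opn c hc hP hb hD hne =>
    obtain ⟨Q', hQ', hr⟩ := h c _ _ hP
      (hsub c hD (hfr.mono_left (Set.subset_insert _ _)))
    exact ⟨_, Step.opn c (Set.disjoint_left.1 hfr (Or.inl rfl)) hQ' hb hD hne, hr⟩

/-- The transitions of a guarded context do not depend on what is in the holes. -/
theorem GuardedRel.matches {X : G.S → Type} {P Q : Proc X} (h : GuardedRel Base P Q) :
    ∀ ρ : ∀ u, X u → Name G u, Matches Base (P.map ρ) (Q.map ρ) := by
  induction h with
  | nil =>
    intro ρ μ P' h
    cases h
  | inp a h =>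
    intro ρ μ P' hP hfr
    cases hP with
    | inp _ _ b hb _ => exact ⟨_, Step.inp _ _ b hb hfr, (h.map _).map _⟩
  | rep a h =>
    intro ρ μ P' hP hfr
    cases hP with
    | rep _ _ b hb _ =>
      exact ⟨_, Step.rep _ _ b hb hfr, .par ((h.map _).map _) (.rep _ (h.map _))⟩
  | out a b =>
    intro ρ μ P' hP hfr
    exact ⟨P', hP, .refl P'⟩
  | par h₁ h₂ ih₁ ih₂ =>
    intro ρ
    exact (ih₁ ρ).par (ih₂ ρ) (h₁.ctxRel.map ρ) (h₂.ctxRel.map ρ)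
  | res h ih =>
    intro ρ
    refine Matches.res fun c => ?_
    rw [Proc.inst_map_liftMap, Proc.inst_map_liftMap]
    exact ih _
  | app h a ih =>
    intro ρ μ P' hP hfr
    cases hP with
    | app _ hP =>
      rw [Proc.inst_map_liftMap] at hP
      obtain ⟨Q', hQ', hr⟩ := ih _ _ _ hP (by
        rw [← Proc.inst_map_liftMap]
        exact hfr.mono_right (Proc.fn_inst_subset_app _ _))
      rw [← Proc.inst_map_liftMap] at hQ'
      exact ⟨Q', Step.app _ hQ', hr⟩

end
end TreesPi

namespace TreesPi

variable {G : Sorting}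

/-! # Substitutions that are performed by contexts -/

/-- `P` and `Q` have the same transitions, under all substitutions, and `P` has all free names of
`Q`. -/
def Unfolds (P Q : PiProc G) : Prop :=
  (∀ (σ : ∀ u, Name G u → Name G u) μ P', Step (P.map σ) μ P' ↔ Step (Q.map σ) μ P') ∧
    Q.fn ⊆ P.fn

theorem Unfolds.refl (P : PiProc G) : Unfolds P P := ⟨fun _ _ _ => Iff.rfl, subset_rfl⟩

theorem Unfolds.of_eq {P Q : PiProc G} (h : P = Q) : Unfolds P Q := h ▸ .refl P

theorem Unfolds.trans {P Q R : PiProc G} (h : Unfolds P Q) (h' : Unfolds Q R) : Unfolds P R :=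
  ⟨fun σ μ P' => (h.1 σ μ P').trans (h'.1 σ μ P'), h'.2.trans h.2⟩

theorem Unfolds.map {P Q : PiProc G} (h : Unfolds P Q) (σ : ∀ u, Name G u → Name G u) :
    Unfolds (P.map σ) (Q.map σ) := by
  refine ⟨fun τ μ P' => ?_, ?_⟩
  · rw [Proc.map_map, Proc.map_map]
    exact h.1 _ μ P'
  · rw [Proc.fn_map, Proc.fn_map]
    exact Set.image_mono h.2

theorem Unfolds.step_iff {P Q : PiProc G} (h : Unfolds P Q) {μ : Act G} {P' : PiProc G} :
    Step P μ P' ↔ Step Q μ P' := by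
  have := h.1 (fun _ x => x) μ P'
  rwa [Proc.map_id, Proc.map_id] at this

theorem Unfolds.app {s : G.S} (P : Proc (Ext (Name G) (One s))) (a : Name G s) :
    Unfolds (Proc.app P a) (P.inst (single a)) := by
  refine ⟨fun σ μ P' => ?_, Proc.fn_inst_subset_app P a⟩
  rw [Proc.map_inst, map_single]
  constructor
  · intro h
    cases h with
    | app _ h => exact h
  · exact fun h => Step.app _ h

/-- A weak transition contains at least one step, and only its first step starts from the process
that is exchanged. -/
theorem Unfolds.weak {P Q : PiProc G} (h : Unfolds P Q) {μ : Act G} {P' : PiProc G} :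
    Weak P μ P' ↔ Weak Q μ P' := by
  have key : ∀ {P Q : PiProc G}, (∀ μ P', Step P μ P' → Step Q μ P') → Weak P μ P' →
      Weak Q μ P' := by
    rintro P Q h ⟨P₁, P₂, h₁, h₂, h₃⟩
    rcases h₁.cases_head with rfl | ⟨P₀, h₀, h₁⟩
    · exact ⟨Q, P₂, .refl, h _ _ h₂, h₃⟩
    · exact ⟨P₁, P₂, .head (h _ _ h₀) h₁, h₂, h₃⟩
  exact ⟨key fun _ _ => h.step_iff.1, key fun _ _ => h.step_iff.2⟩

/-- The process `((c)P)⟨a⟩`. -/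
noncomputable def Proc.sub {s : G.S} (a c : Name G s) (P : PiProc G) : PiProc G :=
  Proc.app (P.bind (single c)) a

/-- Application has no transition of its own: its only rule is to instantiate the parameter. -/
theorem Proc.sub_unfolds {s : G.S} (a c : Name G s) (P : PiProc G) :
    Unfolds (Proc.sub a c P) (P.map (updateName (fun _ x => x) c a)) := by
  have : P.map (updateName (fun _ x => x) c a) = (P.bind (single c)).inst (single a) := by
    simp only [Proc.inst, Proc.bind, Proc.map_map]
    refine Proc.map_congr _ fun u x _ => ?_
    by_cases h : (⟨u, x⟩ : SName G) = ⟨s, c⟩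
    · obtain rfl : u = s := congrArg Sigma.fst h
      obtain rfl := eq_of_heq (Sigma.mk.inj h).2
      rw [updateName_self, dif_pos ⟨⟨rfl⟩, rfl⟩]
      rfl
    · have h' : ¬ ∃ i, single c u i = x := by
        rintro ⟨i, rfl⟩
        exact h (sigma_single c u i)
      rw [updateName_of_ne _ _ h, dif_neg h']
      rfl
  rw [this]
  exact Unfolds.app _ _

theorem Proc.fn_sub {s : G.S} (a c : Name G s) (P : PiProc G) {x : SName G}
    (h : x ∈ (Proc.sub a c P).fn) : x = ⟨s, a⟩ ∨ x ∈ P.fn ∧ x ≠ ⟨s, c⟩ := by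
  rcases h with h | h
  · exact Or.inl h
  · have h' := (Proc.fn_bind P (single c)).1 h
    refine Or.inr ⟨h'.1, ?_⟩
    rintro rfl
    exact h'.2 ⟨rfl⟩ rfl

theorem PreservedByContexts.sub {R : AgentRel G} (hR : PreservedByContexts R) {s : G.S}
    (a c : Name G s) {P Q : PiProc G} (h : R Kind.proc P Q) :
    R Kind.proc (Proc.sub a c P) (Proc.sub a c Q) :=
  hR Kind.proc Kind.proc
    (Ctx.app (Ctx.abs c (Ctx.hole (κ := fun _ : Unit => Kind.proc) ())) a) P Q h

open Classical in
/-- The substitution that behaves as `σ` on the names of a list, and as the identity elsewhere. -/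
noncomputable def restrictName (σ : ∀ u, Name G u → Name G u) (l : List (SName G)) :
    ∀ u, Name G u → Name G u :=
  fun u x => if (⟨u, x⟩ : SName G) ∈ l then σ u x else x

theorem exists_wrap_list (σ : ∀ u, Name G u → Name G u) (l : List (SName G)) :
    ∀ {W B : Set (SName G)}, W.Finite → B.Finite → (∀ x ∈ l, sig σ x ∉ B) →
      (∀ x ∈ W, x ∉ l → x ∉ B) →
    ∃ k : PiProc G → PiProc G,
      (∀ R : AgentRel G, PreservedByContexts R → ∀ P Q, R Kind.proc P Q →
        R Kind.proc (k P) (k Q)) ∧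
      ∀ P : PiProc G, P.fn ⊆ W →
        Unfolds (k P) (P.map (restrictName σ l)) ∧ Disjoint B (k P).fn := by
  induction l with
  | nil =>
    intro W B _ _ _ hW
    refine ⟨id, fun _ _ _ _ h => h, fun P hP => ⟨?_, ?_⟩⟩
    · rw [Proc.map_eq_self fun u x _ => by simp [restrictName]]
      exact .refl P
    · exact Set.disjoint_left.2 fun x hB hx => hW x (hP hx) (by simp) hB
  | cons x l ih =>
    intro W B fW fB hl hW
    have fl : {y | y ∈ l}.Finite := l.finite_toSet
    -- To make the substitution simultaneous, `x` is parked at a fresh `z` while the rest of the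
    -- list is treated, and `z` is finally replaced by `σ x`. As `z` is neither in the list nor the
    -- image of one of its names, no other name is affected.
    obtain ⟨z, hz⟩ := exists_fresh ((fW.union (fB.union (fl.union (fl.image (sig σ))))).insert x) x.1
    simp only [Set.mem_insert_iff, Set.mem_union, Set.mem_ofPred_eq, not_or] at hz
    obtain ⟨hzx, hzW, hzB, hzl, hzσ⟩ := hz
    obtain ⟨k, hk, hk'⟩ := ih (W := insert ⟨x.1, z⟩ (W \ {x})) ((fW.sdiff).insert _) fB
      (fun y hy => hl y (List.mem_cons_of_mem _ hy)) (by
        rintro y (rfl | ⟨hy, hyx⟩) hyl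
        · exact hzB
        · exact hW y hy (by simp [hyl]; exact hyx))
    refine ⟨fun P => Proc.sub (σ x.1 x.2) z (k (Proc.sub z x.2 P)),
      fun R hR P Q h => hR.sub _ _ (hk R hR _ _ (hR.sub _ _ h)), fun P hP => ?_⟩
    obtain ⟨h₁, h₂⟩ := hk' (Proc.sub z x.2 P) fun y hy =>
      (Proc.fn_sub _ _ _ hy).imp id fun h => ⟨hP h.1, h.2⟩
    constructor
    · refine (Proc.sub_unfolds _ _ _).trans ((h₁.trans ((Proc.sub_unfolds _ _ _).map _)).map _
        |>.trans ?_)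
      rw [Proc.map_map, Proc.map_map]
      refine .of_eq (Proc.map_congr P fun u y hy => ?_)
      by_cases hyx : (⟨u, y⟩ : SName G) = x
      · subst hyx
        rw [updateName_self, restrictName, if_neg hzl, updateName_self, restrictName,
          if_pos List.mem_cons_self]
      · rw [updateName_of_ne _ _ hyx]
        by_cases hyl : (⟨u, y⟩ : SName G) ∈ l
        · rw [restrictName, if_pos hyl, restrictName, if_pos (List.mem_cons_of_mem _ hyl),
            updateName_of_ne]
          exact fun e => hzσ ⟨_, hyl, e⟩
        · rw [restrictName, if_neg hyl, restrictName, if_neg (by simp [hyx, hyl]),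
            updateName_of_ne]
          exact fun e => hzW (e ▸ hP hy)
    · refine Set.disjoint_left.2 fun y hB hy => ?_
      rcases Proc.fn_sub _ _ _ hy with rfl | ⟨hy, -⟩
      · exact hl x List.mem_cons_self hB
      · exact Set.disjoint_left.1 h₂ hB hy

/-- Instantiation of the body of an abstraction can be performed by a context, up to unfolding. -/
theorem exists_wrap {s : G.S} (σ : ∀ u, Ext (Name G) (One s) u → Name G u)
    {W B : Set (SName G)} (fW : W.Finite) (fB : B.Finite) (hB : ∀ x, sig σ x ∉ B) :
    ∃ k : Agent (Kind.abs s) → PiProc G,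
      (∀ R : AgentRel G, PreservedByContexts R → ∀ A A', R (Kind.abs s) A A' →
        R Kind.proc (k A) (k A')) ∧
      ∀ A : Agent (Kind.abs s), A.fn ⊆ W →
        Unfolds (k A) (Proc.map σ A) ∧ Disjoint B (k A).fn := by
  obtain ⟨c, hc⟩ := exists_fresh fW s
  have fW' : (insert ⟨s, c⟩ W).Finite := fW.insert _
  -- The abstraction is applied to a fresh `c`, and every possibly free name, including `c`, is then
  -- substituted. Substituting all of them removes the names of `B` also from unused arguments of
  -- applications.
  let l := fW'.toFinset.toList
  have hl : ∀ x, x ∈ l ↔ x ∈ insert ⟨s, c⟩ W := by simp [l]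
  let τ : ∀ u, Name G u → Name G u :=
    updateName (fun u x => σ u (Sum.inl x)) c (σ s (Sum.inr ⟨rfl⟩))
  obtain ⟨k, hk, hk'⟩ := exists_wrap_list τ l fW' fB (by
    intro x _
    by_cases hx : x = ⟨s, c⟩
    · rw [hx, sig_updateName_self]
      exact hB ⟨s, Sum.inr ⟨rfl⟩⟩
    · rw [sig_updateName_of_ne _ _ hx]
      exact hB ⟨x.1, Sum.inl x.2⟩) fun x hx hxl => absurd ((hl x).2 hx) hxl
  refine ⟨fun A => k (Proc.app (X := Name G) A c), fun R hR A A' h => hk R hR _ _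
    (hR (Kind.abs s) Kind.proc (Ctx.app (Ctx.hole (κ := fun _ : Unit => Kind.abs s) ()) c) A A' h),
    fun A hA => ?_⟩
  have hfn : (Proc.app (X := Name G) A c).fn ⊆ insert ⟨s, c⟩ W := by
    rintro x (hx | hx)
    · exact Or.inl hx
    · exact Or.inr (hA hx)
  obtain ⟨h₁, h₂⟩ := hk' _ hfn
  refine ⟨h₁.trans (((Unfolds.app _ _).map _).trans ?_), h₂⟩
  refine .of_eq ((Proc.map_map (X := Ext (Name G) (One s)) A _ _).trans
    (Proc.map_congr _ fun u y hy => ?_))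
  rcases y with y | ⟨⟨rfl⟩⟩
  · have hy' : (⟨u, y⟩ : SName G) ∈ W := hA hy
    have hne : (⟨u, y⟩ : SName G) ≠ ⟨s, c⟩ := fun e => hc (e ▸ hy')
    simp only [Sum.elim_inl, id]
    rw [restrictName, if_pos ((hl _).2 (Or.inr hy'))]
    exact updateName_of_ne _ _ hne
  · change restrictName τ l s c = _
    rw [restrictName, if_pos ((hl _).2 (Or.inl rfl))]
    exact updateName_self _ _ _

theorem Agent.fn_finite {k : Kind G} (A : Agent k) : A.fn.Finite := by
  cases k with
  | proc => exact Proc.fn_finite _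
  | abs s => exact finite_free _

/-! ### The equivalence and substitution instances -/

section

variable {eqv le : AgentRel G}

/-- Equal transitions lead to identical derivatives, so a context without holes satisfies the up-to
requirement. -/
theorem eqv_of_unfolds (hle : ∀ k A, le k A A) (up_to : ValidatesUpTo eqv le) {P Q : PiProc G}
    (h : Unfolds P Q) : eqv Kind.proc P Q := by
  refine up_to (fun P Q => Unfolds P Q ∨ Unfolds Q P) (fun _ _ h => h.symm) ?_ P Q (Or.inl h)
  intro P Q h μ P' hP _
  have hQ : Step Q μ P' := by
    rcases h with h | h
    · exact h.step_iff.1 hP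
    · exact h.step_iff.2 hP
  exact ⟨P', Or.inl ⟨Q, P', .refl, hQ, .refl⟩, 0, Ctx.agent (k := Kind.proc) P', fun _ => .nil,
    fun _ => .nil, hle _ _, hle _ _, fun i => i.elim0⟩

/-- The wrapping context performs `σ`, and both wrapped processes are equivalent to the real
substitution instances. -/
theorem eqv_map_of_eqv (heqv : IsCongruence eqv) (hle : ∀ k A, le k A A)
    (up_to : ValidatesUpTo eqv le) {s : G.S} {A B : Agent (Kind.abs s)}
    (h : eqv (Kind.abs s) A B) (σ : ∀ u, Ext (Name G) (One s) u → Name G u) :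
    eqv Kind.proc (Proc.map σ A) (Proc.map σ B) := by
  obtain ⟨k, hk, hk'⟩ := exists_wrap σ (A.fn_finite.union B.fn_finite) Set.finite_empty
    fun _ => Set.notMem_empty _
  have hA := eqv_of_unfolds hle up_to (hk' A Set.subset_union_left).1
  have hB := eqv_of_unfolds hle up_to (hk' B Set.subset_union_right).1
  have e := heqv.equivalence Kind.proc
  exact e.trans (e.symm hA) (e.trans (hk eqv heqv.context A B h) hB)

/-- An abstraction is recovered by abstracting a fresh name in its instance at that name, so
congruence lifts equivalence of instances to abstractions. -/
theorem eqv_of_eqv_map (heqv : IsCongruence eqv) {s : G.S} {A B : Agent (Kind.abs s)}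
    (h : ∀ σ : ∀ u, Ext (Name G) (One s) u → Name G u,
      eqv Kind.proc (Proc.map σ A) (Proc.map σ B)) : eqv (Kind.abs s) A B := by
  obtain ⟨c, hc⟩ := exists_fresh (A.fn_finite.union B.fn_finite) s
  have key : ∀ C : Agent (Kind.abs s), (⟨s, c⟩ : SName G) ∉ C.fn →
      Proc.bind (Proc.inst (X := Name G) C (single c)) (single c) = C := by
    intro C hC
    refine Proc.bind_inst (single_injective c) fun u i hi => ?_
    have e := sigma_single (X := Name G) c u i
    exact hC (e ▸ hi : _)
  have := heqv.context Kind.proc (Kind.abs s)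
    (Ctx.abs c (Ctx.hole (κ := fun _ : Unit => Kind.proc) ())) _ _
    (h fun u => Sum.elim id (single c u))
  rw [← key A fun h => hc (Or.inl h), ← key B fun h => hc (Or.inr h)]
  exact this

end

/-! # Encodings -/

theorem Agent.map_map {s : G.S} {X Y : G.S → Type} (A : Agent (Kind.abs s))
    (f : ∀ u, Ext (Name G) (One s) u → X u) (g : ∀ u, X u → Y u) :
    Proc.map g (Proc.map f A) = Proc.map (fun u x => g u (f u x)) A :=
  Proc.map_map (X := Ext (Name G) (One s)) A f g

namespace Encoding

variable (E : Encoding G)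

/-- The encoding of a renamed term is a substitution instance of the encoding of the term. -/
theorem exists_enc_rename (g : ℕ → ℕ) : ∃ τ : ∀ u, Name G u → Name G u,
    ∀ M, E.enc (M.rename g) = Proc.map (X := Ext (Name G) (One E.addr)) (liftMap τ) (E.enc M) := by
  classical
  -- `τ` acts as `g` on the names of variables, which are decoded by injectivity of `name`, and as
  -- the identity elsewhere.
  let τ : ∀ u, Name G u → Name G u := fun u y =>
    if h : ∃ x, (⟨u, y⟩ : SName G) = ⟨E.vs, E.name x⟩ then E.name (g h.choose) else y
  refine ⟨τ, fun M => E.uniform g τ (fun x => ?_) M⟩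
  have h : ∃ x', (⟨E.vs, E.name x⟩ : SName G) = ⟨E.vs, E.name x'⟩ := ⟨x, rfl⟩
  have e : x = h.choose := E.name_injective (eq_of_heq (Sigma.mk.inj h.choose_spec).2)
  change dite _ _ _ = _
  rw [dif_pos h, ← e]

theorem enc_lam_openRen {x : ℕ} {M : Term} (h : x ∉ (Term.lam M).fv) :
    E.enc (Term.lam M) = (E.lamC x).fill (fun _ => E.enc (M.rename (Term.openRen x))) := by
  rw [← E.enc_lam, Term.abs_openRen h]

theorem fill_varC (x : ℕ) : ∀ {n : ℕ} (f : Fin n → Term),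
    (E.varC x n).fill (fun i => E.enc (f i)) = E.enc (Term.apps (Term.var x) (List.ofFn f)) := by
  intro n
  induction n with
  | zero => exact fun f => rfl
  | succ n ih =>
    intro f
    -- The last argument is split off, since the variable contexts grow by applying to one more
    -- argument on the right.
    rw [List.ofFn_succ', List.concat_eq_append, Term.apps, List.foldl_append]
    change _ = E.enc (Term.app (Term.apps (Term.var x) (List.ofFn fun i => f i.castSucc)) _)
    rw [E.enc_app, varC, Ctx.fill_comp]
    congr 1
    funext i
    refine Fin.cases ?_ (fun i => ?_) i
    · exact (Ctx.fill_comp _ _ _).trans (ih fun i => f i.castSucc)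
    · obtain rfl := Subsingleton.elim i 0
      rfl

/-! ### Head reduction and the precongruence -/

section

variable {E} {le : AgentRel G} (hle : IsPrecongruence le)
  (beta : E.ValidatesBeta (fun k A B => le k B A))

include hle beta

/-- The renaming `g` makes the induction go through: under an abstraction the body occurs with its
bound index opened to a name, and `le` is not assumed to be closed under renaming. -/
theorem le_enc_of_headStep {M M' : Term} (h : M.HeadStep M') (g : ℕ → ℕ) :
    le _ (E.enc (M'.rename g)) (E.enc (M.rename g)) := by
  induction h generalizing g with
  | beta M N =>
    rw [Term.inst_rename]
    change le _ _ (E.enc (Term.app (Term.lam (M.rename (Term.liftRen g))) (N.rename g)))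
    obtain ⟨x, hx⟩ := (Term.fv_finite (Term.lam (M.rename (Term.liftRen g)))).exists_notMem
    rw [← Term.abs_openRen hx, ← Term.substVar_openRen hx]
    exact beta x _ _
  | @appL M M' N _ _ ih =>
    simp only [Term.rename, E.enc_app]
    have key : ∀ A : Agent (Kind.abs E.addr),
        (E.appC.comp ![Ctx.hole (κ := fun _ : Unit => Kind.abs E.addr) (),
          Ctx.agent (E.enc (N.rename g))]).fill (fun _ => A) =
            E.appC.fill ![A, E.enc (N.rename g)] := by
      intro A
      rw [Ctx.fill_comp]
      congr 1
      funext i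
      fin_cases i <;> rfl
    have := hle.context _ _ (E.appC.comp ![Ctx.hole (κ := fun _ : Unit => Kind.abs E.addr) (),
      Ctx.agent (E.enc (N.rename g))]) _ _ (ih g)
    rwa [key, key] at this
  | @lam M M' _ ih =>
    simp only [Term.rename]
    obtain ⟨x, hx⟩ := ((Term.fv_finite (Term.lam (M.rename (Term.liftRen g)))).union
      (Term.fv_finite (Term.lam (M'.rename (Term.liftRen g))))).exists_notMem
    rw [E.enc_lam_openRen fun h => hx (Or.inl h), E.enc_lam_openRen fun h => hx (Or.inr h),
      Term.rename_rename, Term.rename_rename]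
    exact hle.context _ _ (E.lamC x) _ _ (ih _)

theorem le_enc_of_headRed {M M' : Term} (h : M.HeadRed M') : le _ (E.enc M') (E.enc M) := by
  induction h with
  | refl => exact hle.refl _ _
  | tail _ h ih =>
    have := le_enc_of_headStep hle beta h id
    rw [Term.rename_id, Term.rename_id] at this
    exact hle.trans _ _ _ _ this ih

end

/-- Pairs of encodings of terms with the same tree. -/
def EncPair : Proc (Ext (Name G) (One E.addr)) → Proc (Ext (Name G) (One E.addr)) → Prop :=
  fun A B => ∃ M N, LT M = LT N ∧ A = E.enc M ∧ B = E.enc N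

/-- The encodings of head normal forms that agree up to subterms with the same tree are obtained
from a common guarded context. -/
theorem guardedRel_hnf (hvar : ∀ x n, (E.varC x n).Guarded) {k : ℕ} {f g : Fin k → Term}
    (hfg : ∀ i, LT (f i) = LT (g i)) (y n : ℕ) : ∀ r : ℕ → ℕ,
    AgentGuardedRel E.EncPair (Kind.abs E.addr)
      (E.enc ((Term.lams n (Term.apps (Term.var y) (List.ofFn f))).rename r))
      (E.enc ((Term.lams n (Term.apps (Term.var y) (List.ofFn g))).rename r)) := by
  induction n with
  | zero =>
    intro r
    simp only [Term.lams, Term.apps_rename, List.map_ofFn, Term.rename]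
    rw [← E.fill_varC, ← E.fill_varC]
    -- The arguments sit in the holes of the guarded variable context; the renaming `r` becomes a
    -- substitution at the holes.
    refine AgentGuardedRel.fill_of_guarded _ (hvar _ _) fun i => ?_
    obtain ⟨τ, hτ⟩ := E.exists_enc_rename r
    simp only [Function.comp_apply]
    rw [hτ, hτ]
    exact CtxRel.hole ⟨_, _, hfg i, rfl, rfl⟩ _
  | succ n ih =>
    intro r
    simp only [Term.lams, Term.rename]
    obtain ⟨x, hx⟩ := ((Term.fv_finite (Term.lam
      ((Term.lams n (Term.apps (Term.var y) (List.ofFn f))).rename (Term.liftRen r)))).union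
      (Term.fv_finite (Term.lam
      ((Term.lams n (Term.apps (Term.var y) (List.ofFn g))).rename
        (Term.liftRen r))))).exists_notMem
    rw [E.enc_lam_openRen fun h => hx (Or.inl h), E.enc_lam_openRen fun h => hx (Or.inr h),
      Term.rename_rename, Term.rename_rename]
    exact AgentGuardedRel.fill _ fun _ => ih _

/-! ### Completeness by the up-to technique -/

section

variable {E} {eqv le : AgentRel G} (heqv : IsCongruence eqv) (hle : IsPrecongruence le)
  (up_to : ValidatesUpTo eqv le)

include heqv hle up_to

/-- An abstraction context encloses a renamed body, so congruence alone does not suffice: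
equivalence must first be transferred to renamed encodings. -/
theorem eqv_enc_lams {M N : Term} (h : eqv _ (E.enc M) (E.enc N)) (n : ℕ) :
    eqv _ (E.enc (Term.lams n M)) (E.enc (Term.lams n N)) := by
  induction n with
  | zero => exact h
  | succ n ih =>
    obtain ⟨x, hx⟩ := ((Term.fv_finite (Term.lam (Term.lams n M))).union
      (Term.fv_finite (Term.lam (Term.lams n N)))).exists_notMem
    rw [Term.lams, Term.lams, E.enc_lam_openRen fun h => hx (Or.inl h),
      E.enc_lam_openRen fun h => hx (Or.inr h)]
    refine heqv.context _ _ (E.lamC x) _ _ (eqv_of_eqv_map heqv fun σ => ?_)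
    obtain ⟨τ, hτ⟩ := E.exists_enc_rename (Term.openRen x)
    rw [hτ, hτ, Agent.map_map, Agent.map_map]
    exact eqv_map_of_eqv heqv hle.refl up_to ih _

variable (eqv_of_ge : ∀ k A B, le k B A → eqv k A B)
  (beta : E.ValidatesBeta (fun k A B => le k B A))
  (order_zero : ∀ M : Term, M.UnsolvableOfOrder 0 → eqv _ (E.enc M) (E.enc Term.Omega))
  (order_inf : ∀ M N : Term, M.UnsolvableOfOrderInf → N.UnsolvableOfOrderInf →
    eqv _ (E.enc M) (E.enc N))

include eqv_of_ge beta order_zero order_inf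

/-- Unsolvables of order `n` head-reduce to `n` abstractions over unsolvables of order `0`, both
equivalent to the encoding of `Ω`; order `∞` is a hypothesis. Only similar head normal forms remain
for the coinductive argument. -/
theorem similarHnf_or_eqv {M N : Term} (h : LT M = LT N) :
    M.SimilarHnf N ∨ eqv _ (E.enc M) (E.enc N) := by
  rcases Term.cases_of_LT_eq h with h | ⟨n, hM, hN⟩ | ⟨hM, hN⟩
  · exact Or.inl h
  · right
    obtain ⟨M', hM, hM'⟩ := hM.exists_lams
    obtain ⟨N', hN, hN'⟩ := hN.exists_lams
    have e := heqv.equivalence (Kind.abs E.addr)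
    have h' : eqv _ (E.enc M') (E.enc N') := e.trans (order_zero M' hM') (e.symm (order_zero N' hN'))
    exact e.trans (eqv_of_ge _ _ _ (le_enc_of_headRed hle beta hM))
      (e.trans (eqv_enc_lams heqv hle up_to h' n)
        (e.symm (eqv_of_ge _ _ _ (le_enc_of_headRed hle beta hN))))
  · exact Or.inr (order_inf M N hM hN)

/-- The instances of the encodings of terms with similar head normal forms are equivalent. -/
theorem eqv_map_of_similarHnf (hexp : IsExpansion (le Kind.proc))
    (hvar : ∀ x n, (E.varC x n).Guarded) {M N : Term} (h : M.SimilarHnf N)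
    (σ : ∀ u, Ext (Name G) (One E.addr) u → Name G u) :
    eqv Kind.proc (Proc.map σ (E.enc M)) (Proc.map σ (E.enc N)) := by
  -- Membership is up to `Unfolds`, because the processes that `le` relates are wrapped encodings,
  -- which merely unfold to substitution instances.
  let R : PiProc G → PiProc G → Prop := fun P Q =>
    ∃ (M N : Term) (σ : ∀ u, Ext (Name G) (One E.addr) u → Name G u), M.SimilarHnf N ∧
      Unfolds P (Proc.map σ (E.enc M)) ∧ Unfolds Q (Proc.map σ (E.enc N))
  refine up_to R ?_ ?_ _ _ ⟨M, N, σ, h, .refl _, .refl _⟩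
  · rintro P Q ⟨M, N, σ, ⟨n, y, k, f, g, hM, hN, hfg⟩, hP, hQ⟩
    exact ⟨N, M, σ, ⟨n, y, k, g, f, hN, hM, fun i => (hfg i).symm⟩, hQ, hP⟩
  clear h M N σ
  rintro P Q ⟨M, N, σ, ⟨n, y, k, f, g, hM, hN, hfg⟩, hP, hQ⟩ μ P' hstep hfr
  -- The bound names of `μ` are known to be fresh only for `Q`. Those free in the instance on the
  -- left are replaced, which keeps the transition and, by freshness, does not change the instance
  -- on the right.
  obtain ⟨e, he, hstep'⟩ := (hP.step_iff.1 hstep).exists_avoid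
  rw [Agent.map_map] at hstep'
  set σ' : ∀ u, Ext (Name G) (One E.addr) u → Name G u :=
    fun u x => avoid μ.bn e u (σ u x)
  have hQ' : Unfolds Q (Proc.map σ' (E.enc N)) := by
    refine hQ.trans (.of_eq ?_)
    refine Eq.trans ?_ (Proc.map_map _ _ _)
    refine (Proc.map_eq_self fun u x hx => eq_of_sig_eq (sig_avoid_of_notMem e fun hb => ?_)).symm
    exact Set.disjoint_left.1 hfr hb (hQ.2 hx)
  set HM := Term.lams n (Term.apps (Term.var y) (List.ofFn f))
  set HN := Term.lams n (Term.apps (Term.var y) (List.ofFn g))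
  have fμ : μ.bn.Finite := hstep.names_finite.subset μ.bn_subset_names
  -- A single context performs `σ'` on all four encodings, so that `le` is preserved; the results
  -- avoid the bound names of `μ`, as the expansion clauses require.
  obtain ⟨w, hw, hw'⟩ := exists_wrap σ'
    (((E.enc M).fn_finite.union (E.enc N).fn_finite).union
      ((E.enc HM).fn_finite.union (E.enc HN).fn_finite)) fμ
    fun x => sig_avoid_notMem he (sig σ x)
  obtain ⟨uM, -⟩ := hw' (E.enc M) fun x hx => Or.inl (Or.inl hx)
  obtain ⟨uN, dN⟩ := hw' (E.enc N) fun x hx => Or.inl (Or.inr hx)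
  obtain ⟨uHM, dHM⟩ := hw' (E.enc HM) fun x hx => Or.inr (Or.inl hx)
  obtain ⟨uHN, dHN⟩ := hw' (E.enc HN) fun x hx => Or.inr (Or.inr hx)
  have leM := hw le hle.context _ _ (le_enc_of_headRed hle beta hM)
  have leN := hw le hle.context _ _ (le_enc_of_headRed hle beta hN)
  obtain ⟨P₁, hP₁, leP₁⟩ := (hexp _ _ leM).2 _ _ (uM.step_iff.2 hstep') dHM
  rcases hP₁ with hP₁ | ⟨rfl, rfl⟩
  · have hrel := E.guardedRel_hnf hvar hfg y n id
    rw [Term.rename_id, Term.rename_id] at hrel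
    have hrel' := GuardedRel.matches (X := Ext (Name G) (One E.addr)) hrel σ'
    -- Guardedness transfers the transition between the two head normal forms; the first expansion
    -- clause then lifts it to a weak transition of `N`.
    obtain ⟨Q₁, hQ₁, hr⟩ := hrel' μ P₁ (uHM.step_iff.1 hP₁) (dHN.mono_right uHN.2)
    obtain ⟨Q', hwQ, leQ⟩ := (hexp _ _ leN).1 μ Q₁ (uHN.step_iff.2 hQ₁) dN
    obtain ⟨m, C, Ps, Qs, hPs, hQs, hi⟩ := hr.exists_ctx fun _ x => x
    rw [Proc.map_id] at hPs hQs
    refine ⟨Q', Or.inl (hQ'.weak.2 (uN.weak.1 hwQ)), m, C, Ps, Qs, ?_, ?_, fun i => ?_⟩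
    · rwa [hPs]
    · rwa [hQs]
    obtain ⟨_, _, ρ, ⟨M', N', hLT, rfl, rfl⟩, hPi, hQi⟩ := hi i
    rw [hPi, hQi]
    rcases similarHnf_or_eqv heqv hle up_to eqv_of_ge beta order_zero order_inf hLT with h | h
    -- Pairs in `R` remain there under every substitution, which covers holes under inputs.
    · exact Or.inr ⟨⟨M', N', ρ, h, .refl _, .refl _⟩, fun _ τ => ⟨M', N', _, h,
        .of_eq (Agent.map_map _ _ _), .of_eq (Agent.map_map _ _ _)⟩⟩
    · exact Or.inl (eqv_map_of_eqv heqv hle.refl up_to h ρ)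
  -- The head normal form does not match the `τ`: `Q` stays put, and the new pair, with `M` replaced
  -- by its head normal form, is in `R` and fills the trivial context.
  · exact ⟨Q, Or.inr ⟨rfl, .refl⟩, 1, Ctx.hole (κ := fun _ : Fin 1 => Kind.proc) 0,
      fun _ => w (E.enc HM), fun _ => Q, leP₁, hle.refl _ _, fun _ => Or.inr
      ⟨⟨HM, N, σ', ⟨n, y, k, f, g, .refl, hN, hfg⟩, uHM, hQ'⟩, fun h => h.elim⟩⟩

end

end Encoding

end TreesPi

theorem theoremt (G : TreesPi.Sorting) (E : TreesPi.Encoding G)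
    (eqv le : TreesPi.AgentRel G)
    -- the congruence contains the converse of `le`
    (eqv_congruence : TreesPi.IsCongruence eqv)
    (eqv_of_ge : ∀ k A B, le k B A → eqv k A B)
    -- `le` is an expansion relation and a precongruence
    (le_expansion : TreesPi.IsExpansion (le TreesPi.Kind.proc))
    (le_precongruence : TreesPi.IsPrecongruence le)
    (up_to : TreesPi.ValidatesUpTo eqv le)
    -- the variable contexts are guarded
    (varC_guarded : ∀ x n, (E.varC x n).Guarded)
    -- the encoding and the converse of `le` validate rule `β`
    (beta : E.ValidatesBeta (fun k A B => le k B A))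
    -- the unsolvables of order `0`
    (order_zero : ∀ M : TreesPi.Term, M.UnsolvableOfOrder 0 →
      eqv _ (E.enc M) (E.enc TreesPi.Term.Omega))
    -- the unsolvables of order `∞`
    (order_inf : ∀ M N : TreesPi.Term, M.UnsolvableOfOrderInf → N.UnsolvableOfOrderInf →
      eqv _ (E.enc M) (E.enc N)) :
    E.CompleteLT eqv ∧ (E.SoundLT eqv → E.FullyAbstractLT eqv) := by
  have complete : E.CompleteLT eqv := by
    intro M N h
    rcases TreesPi.Encoding.similarHnf_or_eqv eqv_congruence le_precongruence up_to eqv_of_ge beta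
      order_zero order_inf h with h | h
    · exact TreesPi.eqv_of_eqv_map eqv_congruence fun σ =>
        TreesPi.Encoding.eqv_map_of_similarHnf eqv_congruence le_precongruence up_to eqv_of_ge beta
          order_zero order_inf le_expansion varC_guarded h σ
    · exact h
  exact ⟨complete, fun sound => ⟨sound, complete⟩⟩
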